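/- Let $\mathbb K$ be a field and let $A=\bigoplus_{n\ge 0}A_n$ be an $\mathbb N$-graded $\mathbb K$-algebra that is connected ($A_0=\mathbb K$), locally finite ($\dim_{\mathbb K}A_n<\infty$ for all $n$) and generated in degree one. Let $A_+=\bigoplus_{n\ge 1}A_n$, and let $\mathbb K_A=A/A_+$ be the trivial right $A$-module. A graded free resolution $$\cdots\to P_2\to P_1\to P_0\to\mathbb K_A\to 0,\qquad P_i=\bigoplus_{s}A(-\alpha_{i,s}),\quad \alpha_{i,s}\in\mathbb Z,$$ is *minimal* if the image of $P_{i+1}\to P_i$ lies in $P_iA_+$ for all $i\ge 0$, and it is *finite of length $d$* if all $P_i$ have finite rank and $P_i=0$ for $i>d$. * $A$ is *monotonic* if it has finite global dimension $d$ and $\mathbb K_A$ has a minimal graded free resolution, finite of length $d$, such that for every $0\le i<d$ one has $\max_s\alpha_{i,s}\le\min_s\alpha_{i+1,s}$. * $A$ has a *pure minimal resolution* if it has finite global dimension $d$ and $\mathbb K_A$ has a minimal graded free resolution, finite of length $d$, in which each $P_i$ is generated in a single degree, that is, $\alpha_{i,s}$ depends only on $i$. * $A$ is *Koszul*, *$N$-Koszul*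 ($N\ge 2$), respectively *piecewise Koszul* with parameters $2\le p\le N$, if $\mathbb K_A$ has a minimal graded free resolution in which every $P_i$ is generated in degree $i$; in degree $jN+r$ where $i=2j+r$, $r\in\{0,1\}$; respectively in degree $jN+r$ where $i=jp+r$, $0\le r<p$. * $A$ is *Artin-Schelter regular of dimension $d$* if it has finite global dimension $d$; there is an integer $l$ such that the graded Ext groups satisfy $\underline{\mathrm{Ext}}^i_A(\mathbb K_A,A_A)=0$ for $i\ne d$ and $\underline{\mathrm{Ext}}^d_A(\mathbb K_A,A_A)\cong\mathbb K(l)$, the trivial module placed in degree $-l$; and there are constants $c,e>0$ with $\dim_{\mathbb K} A_n\le c\,n^e$ for all $n\ge 1$. * $A$ is *quadratic* if the kernel of the canonical map $T(A_1)\to A$ is generated, as a two-sided ideal, by elements of $A_1\otimes A_1$. Then: (a) If $A$ has a pure minimal resolution, then $A$ is monotonic. In particular, every Koszul, $N$-Koszul or piecewise Koszul algebra $A$ of finite global dimension has a pure minimal resolution and is monotonic. (b) If $A$ is Artin-Schelter regular of dimension at most $4$, then $A$ is monotonic. (c) If $A$ is quadratic and Artin-Schelter regular of dimension at most $6$, then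 $A$ is monotonic. -/

import Mathlib

open CategoryTheory

noncomputable section

namespace MonotonicAlg

/-! ### Global dimension -/

/-- The (right) global dimension of a ring: the supremum of the projective dimensions of all
right `A`-modules. Right `A`-modules are modules over `Aᵐᵒᵖ`. -/
def rightGlobalDimension.{u} (A : Type u) [Ring A] : WithBot ℕ∞ :=
  ⨆ M : ModuleCat.{u} Aᵐᵒᵖ, projectiveDimension M

section

variable {K A : Type*} [Field K] [Ring A] [Algebra K A]

/-! ### Connected graded algebras -/

/-- The standing assumptions on an `ℕ`-graded algebra `A = ⨁ₙ 𝒜 n` over a field `K`: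
connected, locally finite, and generated in degree one. -/
structure IsStandardGraded (𝒜 : ℕ → Submodule K A) : Prop where
  nontrivial : Nontrivial A
  /-- `A₀ = K`; the `1` on the right is the image of `K` in `A`. -/
  connected : 𝒜 0 = 1
  locallyFinite : ∀ n, FiniteDimensional K (𝒜 n)
  generated : Algebra.adjoin K (𝒜 1 : Set A) = ⊤

/-- The homogeneous component of `A` in an integer degree; it is zero in negative degrees. -/
def component (𝒜 : ℕ → Submodule K A) (n : ℤ) : Submodule K A :=
  if 0 ≤ n then 𝒜 n.toNat else ⊥

/-- A connected graded algebra is quadratic if it is generated in degree one and the kernel of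
the canonical map from the tensor algebra `T(A₁) → A` is generated, as a two-sided ideal, by
elements of `A₁ ⊗ A₁`. -/
def IsQuadratic (𝒜 : ℕ → Submodule K A) : Prop :=
  Algebra.adjoin K (𝒜 1 : Set A) = ⊤ ∧
    TwoSidedIdeal.ker (TensorAlgebra.lift K (𝒜 1).subtype) =
      TwoSidedIdeal.span
        {r : TensorAlgebra K (𝒜 1) |
          r ∈ LinearMap.range (TensorAlgebra.ι K (M := 𝒜 1)) ^ 2 ∧
            TensorAlgebra.lift K (𝒜 1).subtype r = 0}

/-- Finite Gelfand-Kirillov dimension: the dimensions of the homogeneous components are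
bounded by a power of the degree. -/
def HasFiniteGKDim (𝒜 : ℕ → Submodule K A) : Prop :=
  ∃ c e : ℝ, 0 < c ∧ 0 < e ∧ ∀ n : ℕ, 1 ≤ n → (Module.finrank K (𝒜 n) : ℝ) ≤ c * (n : ℝ) ^ e

variable (𝒜 : ℕ → Submodule K A) [GradedAlgebra 𝒜]

/-- The augmentation ideal `A₊ = ⨁_{n ≥ 1} Aₙ`, as a right ideal: the elements whose component
of degree zero vanishes. -/
def augmentationIdeal : Submodule Aᵐᵒᵖ A where
  carrier := {a | GradedRing.projZeroRingHom 𝒜 a = 0}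
  add_mem' := by
    intro a b ha hb
    simp only [Set.mem_ofPred_eq] at ha hb ⊢
    rw [map_add, ha, hb, add_zero]
  zero_mem' := map_zero _
  smul_mem' := by
    intro c a ha
    simp only [Set.mem_ofPred_eq] at ha ⊢
    rw [MulOpposite.smul_eq_mul_unop, map_mul, ha, zero_mul]

/-- The trivial right `A`-module `K = A / A₊`; as a graded module it is concentrated in
degree zero. -/
abbrev TrivialModule : Type _ := A ⧸ augmentationIdeal 𝒜

/-! ### Graded free resolutions of the trivial module -/

/-- A graded free resolution `⋯ ⟶ P₂ ⟶ P₁ ⟶ P₀ ⟶ K ⟶ 0` of the trivial right module. The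
module `Pᵢ = ⨁ₛ A(-αᵢₛ)` is the free right module on the index set `ι i`, of arbitrary (possibly
infinite or zero) rank, and its basis vector `s` has degree `αᵢₛ = deg i s`. All the
maps preserve degrees. (As `A` is locally finite, countable index sets suffice.) -/
structure GradedFreeResolution where
  ι : ℕ → Type
  deg : ∀ i, ι i → ℤ
  d : ∀ i, (ι (i + 1) →₀ A) →ₗ[Aᵐᵒᵖ] (ι i →₀ A)
  ε : (ι 0 →₀ A) →ₗ[Aᵐᵒᵖ] TrivialModule 𝒜
  /-- The image of the basis vector `t` is homogeneous of degree `deg (i + 1) t`. -/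
  d_homogeneous : ∀ i t s, d i (Finsupp.single t 1) s ∈ component 𝒜 (deg (i + 1) t - deg i s)
  /-- The trivial module lives in degree zero. -/
  ε_homogeneous : ∀ s, deg 0 s ≠ 0 → ε (Finsupp.single s 1) = 0
  exact : ∀ i, Function.Exact (d (i + 1)) (d i)
  exact_zero : Function.Exact (d 0) ε
  ε_surjective : Function.Surjective ε

namespace GradedFreeResolution

variable {𝒜}
variable (P : GradedFreeResolution 𝒜)

/-- The resolution is minimal: `im (Pᵢ₊₁ ⟶ Pᵢ) ⊆ Pᵢ A₊` for all `i`. -/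
def IsMinimal : Prop :=
  ∀ i x s, P.d i x s ∈ augmentationIdeal 𝒜

/-- A finite free resolution of length `d`: every `Pᵢ` has finite rank, and `Pᵢ = 0` for
`i > d`. -/
def IsFiniteOfLength (d : ℕ) : Prop :=
  (∀ i, Finite (P.ι i)) ∧ ∀ i, d < i → IsEmpty (P.ι i)

/-- The homomorphisms `Pᵢ ⟶ A` of right modules that are homogeneous of degree `n`, that is, the
component of degree `n` of the graded `Hom(Pᵢ, A)`. -/
def gradedHom (i : ℕ) (n : ℤ) : Submodule K ((P.ι i →₀ A) →ₗ[Aᵐᵒᵖ] A) where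
  carrier := {f | ∀ s, f (Finsupp.single s 1) ∈ component 𝒜 (n + P.deg i s)}
  add_mem' hf hg s := add_mem (hf s) (hg s)
  zero_mem' _ := zero_mem _
  smul_mem' c _ hf s := (component 𝒜 _).smul_mem c (hf s)

/-- Composition with the differential, `Hom(Pᵢ, A) ⟶ Hom(Pᵢ₊₁, A)`. -/
def precomp (i : ℕ) :
    ((P.ι i →₀ A) →ₗ[Aᵐᵒᵖ] A) →ₗ[K] ((P.ι (i + 1) →₀ A) →ₗ[Aᵐᵒᵖ] A) where
  toFun f := f ∘ₗ P.d i
  map_add' _ _ := rfl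
  map_smul' _ _ := rfl

/-- Cocycles of degree `n` in `Hom(Pᵢ, A)`. -/
def cocycles (i : ℕ) (n : ℤ) : Submodule K ((P.ι i →₀ A) →ₗ[Aᵐᵒᵖ] A) :=
  P.gradedHom i n ⊓ LinearMap.ker (P.precomp i)

/-- Coboundaries of degree `n` in `Hom(Pᵢ, A)`. -/
def coboundaries : (i : ℕ) → (n : ℤ) → Submodule K ((P.ι i →₀ A) →ₗ[Aᵐᵒᵖ] A)
  | 0, _ => ⊥
  | i + 1, n => (P.gradedHom i n).map (P.precomp i)

/-- The component of degree `n` of the graded `Ext^i(K, A)`, computed from the resolution `P`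
as the cohomology of the complex of graded homomorphisms into `A`: cocycles modulo coboundaries,
realised as the image of the cocycles in `Hom(Pᵢ, A)` modulo coboundaries. -/
def gradedExt (i : ℕ) (n : ℤ) :
    Submodule K (((P.ι i →₀ A) →ₗ[Aᵐᵒᵖ] A) ⧸ P.coboundaries i n) :=
  (P.cocycles i n).map (P.coboundaries i n).mkQ

end GradedFreeResolution

/-! ### The classes of algebras -/

/-- `A` is monotonic: it has finite global dimension `d`, and the trivial module has a minimal
finite free resolution of length `d` with `max {αᵢₛ | s} ≤ min {αᵢ₊₁ₜ | t}` for all `i`. -/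
def IsMonotonic : Prop :=
  ∃ d : ℕ, rightGlobalDimension A = d ∧
    ∃ P : GradedFreeResolution 𝒜, P.IsMinimal ∧ P.IsFiniteOfLength d ∧
      ∀ i s t, P.deg i s ≤ P.deg (i + 1) t

/-- `A` has finite global dimension `d`, and the trivial module has a minimal finite free
resolution of length `d` in which every `Pᵢ` is generated in a single degree. -/
def HasPureMinimalResolution : Prop :=
  ∃ d : ℕ, rightGlobalDimension A = d ∧
    ∃ P : GradedFreeResolution 𝒜, P.IsMinimal ∧ P.IsFiniteOfLength d ∧
      ∀ i, ∃ a : ℤ, ∀ s, P.deg i s = a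

/-- `A` is Koszul: the trivial module has a minimal graded free resolution in which `Pᵢ` is
generated in degree `i`. -/
def IsKoszul : Prop :=
  ∃ P : GradedFreeResolution 𝒜, P.IsMinimal ∧ ∀ i s, P.deg i s = i

/-- `A` is `N`-Koszul: the trivial module has a minimal graded free resolution in which `Pᵢ` is
generated in degree `jN` if `i = 2j`, and in degree `jN + 1` if `i = 2j + 1`. -/
def IsNKoszul (N : ℕ) : Prop :=
  2 ≤ N ∧ ∃ P : GradedFreeResolution 𝒜, P.IsMinimal ∧
    ∀ i s, P.deg i s = ((i / 2 * N + i % 2 : ℕ) : ℤ)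

/-- `A` is piecewise Koszul with period `p` and jump degree `N`, where `2 ≤ p ≤ N`: the trivial
module has a minimal graded free resolution in which `Pᵢ` is generated in degree `jN + r` if
`i = jp + r` with `0 ≤ r < p`. -/
def IsPiecewiseKoszul (p N : ℕ) : Prop :=
  2 ≤ p ∧ p ≤ N ∧ ∃ P : GradedFreeResolution 𝒜, P.IsMinimal ∧
    ∀ i s, P.deg i s = ((i / p * N + i % p : ℕ) : ℤ)

/-- The Gorenstein condition with AS-index `l`: the graded `Ext^i(K, A)` is zero for `i ≠ d` and
is `K(l)`, the trivial module placed in degree `-l`, for `i = d`. A graded module that is zero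
outside one degree and one-dimensional there is automatically a shift of the trivial module, since
`A₊` raises degrees. The trivial module has a graded free resolution (over a connected locally
finite algebra, even a minimal one of countable rank) and `Ext` does not depend on it, so
asking for the condition in every resolution is the same as asking for it in one. -/
def IsGorenstein (d : ℕ) (l : ℤ) : Prop :=
  ∀ P : GradedFreeResolution 𝒜,
    (∀ (i : ℕ) (n : ℤ), ¬ (i = d ∧ n = -l) → Subsingleton (P.gradedExt i n)) ∧
      Module.finrank K (P.gradedExt d (-l)) = 1

/-- Artin-Schelter regular algebras of dimension `d`. -/
structure IsASRegular (d : ℕ) : Prop where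
  globalDimension : rightGlobalDimension A = d
  gorenstein : ∃ l : ℤ, IsGorenstein 𝒜 d l
  finiteGKDim : HasFiniteGKDim 𝒜

end

end MonotonicAlg

end

namespace MonotonicAlg

open MulOpposite

/-! ### Homogeneous components in integer degrees -/

section Components

variable {K A : Type*} [Field K] [Ring A] [Algebra K A]

/-! Monotonicity compares the generator degrees of consecutive terms of a minimal resolution, and
minimality gives half of it: the differential has entries in `A₊`, so a generator of `Pᵢ₊₁` lies in
degree above some generator of `Pᵢ` (`exists_deg_lt`). Hence all degrees of `Pᵢ₊₁` exceed those of
`Pᵢ` once `Pᵢ` is pure, which proves (a). For Koszul-type algebras it remains to bound the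
resolution. By graded Nakayama, a minimal cover of a projective module is injective, so the
resolution stops at the global dimension (`d_eq_zero`); purity and local finiteness then give finite
ranks.

For Artin-Schelter regular algebras, the Gorenstein condition makes `Hom(P, A)` a minimal resolution
of a shift of the trivial left module. So a generator of `Pᵢ` with `i < d` lies in degree below some
generator of `Pᵢ₊₁` (`exists_lt_deg`), and purity of the target `Pᵢ₊₁` also suffices. It is thus
enough that every arrow has a pure end.

Generation in degree one makes `P₀` and `P₁` pure of degrees 0 and 1; the same argument in the dual
complex gives degrees `l` and `l - 1` for `P_d` and `P_{d-1}`. These four terms touch every arrow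
when `d ≤ 4`. If `A` is quadratic, the linear relations among a basis of `A₁`, on either side, are
generated by those with coefficients in `A₁`; so `P₂` and `P_{d-2}` are pure of degrees 2 and `l -
2`, and every arrow is covered for `d ≤ 6`. -/

theorem component_natCast (𝒜 : ℕ → Submodule K A) (n : ℕ) : component 𝒜 (n : ℤ) = 𝒜 n := by
  simp [component]

theorem component_of_neg (𝒜 : ℕ → Submodule K A) {n : ℤ} (hn : n < 0) : component 𝒜 n = ⊥ := by
  simp [component, hn]

theorem eq_zero_of_mem_component {𝒜 : ℕ → Submodule K A} {n : ℤ} (hn : n < 0) {a : A}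
    (ha : a ∈ component 𝒜 n) : a = 0 := by
  simpa [component_of_neg 𝒜 hn] using ha

theorem IsStandardGraded.exists_smul_one {𝒜 : ℕ → Submodule K A} (h𝒜 : IsStandardGraded 𝒜) {a : A}
    (ha : a ∈ component 𝒜 0) : ∃ c : K, a = c • 1 := by
  have h := component_natCast 𝒜 0
  rw [Nat.cast_zero] at h
  rw [h, h𝒜.connected, Submodule.mem_one] at ha
  obtain ⟨c, rfl⟩ := ha
  exact ⟨c, Algebra.algebraMap_eq_smul_one c⟩

variable (𝒜 : ℕ → Submodule K A) [GradedAlgebra 𝒜]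

theorem one_mem_component : (1 : A) ∈ component 𝒜 0 := by
  have h := component_natCast 𝒜 0
  rw [Nat.cast_zero] at h
  rw [h]
  exact SetLike.one_mem_graded 𝒜

theorem mul_mem_component {p q : ℤ} {a b : A} (ha : a ∈ component 𝒜 p) (hb : b ∈ component 𝒜 q) :
    a * b ∈ component 𝒜 (p + q) := by
  rcases lt_or_ge p 0 with hp | hp
  · rw [eq_zero_of_mem_component hp ha, zero_mul]
    exact zero_mem _
  rcases lt_or_ge q 0 with hq | hq
  · rw [eq_zero_of_mem_component hq hb, mul_zero]
    exact zero_mem _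
  lift p to ℕ using hp
  lift q to ℕ using hq
  rw [← Nat.cast_add, component_natCast]
  rw [component_natCast] at ha hb
  exact SetLike.mul_mem_graded ha hb

instance finiteDimensional_component {𝒜 : ℕ → Submodule K A} [h : ∀ n, FiniteDimensional K (𝒜 n)]
    (n : ℤ) : FiniteDimensional K (component 𝒜 n) := by
  rcases lt_or_ge n 0 with hn | hn
  · rw [component_of_neg 𝒜 hn]
    infer_instance
  · lift n to ℕ using hn
    rw [component_natCast]
    exact h n

/-- The projection onto the homogeneous component of integer degree `n`. -/
def intProj (n : ℤ) : A →ₗ[K] A :=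
  if 0 ≤ n then GradedAlgebra.proj 𝒜 n.toNat else 0

theorem intProj_natCast (n : ℕ) (a : A) :
    intProj 𝒜 n a = (DirectSum.decompose 𝒜 a n : A) := by
  simp [intProj, GradedAlgebra.proj_apply]

theorem intProj_zero (a : A) : intProj 𝒜 0 a = (DirectSum.decompose 𝒜 a 0 : A) :=
  intProj_natCast 𝒜 0 a

theorem intProj_of_neg {n : ℤ} (hn : n < 0) (a : A) : intProj 𝒜 n a = 0 := by
  simp [intProj, hn.not_ge]

theorem intProj_mem (n : ℤ) (a : A) : intProj 𝒜 n a ∈ component 𝒜 n := by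
  rcases lt_or_ge n 0 with hn | hn
  · rw [intProj_of_neg 𝒜 hn]
    exact zero_mem _
  · lift n to ℕ using hn
    rw [intProj_natCast, component_natCast]
    exact SetLike.coe_mem _

variable {𝒜}

theorem intProj_of_mem {n : ℤ} {a : A} (ha : a ∈ component 𝒜 n) : intProj 𝒜 n a = a := by
  rcases lt_or_ge n 0 with hn | hn
  · rw [eq_zero_of_mem_component hn ha, map_zero]
  · lift n to ℕ using hn
    rw [component_natCast] at ha
    rw [intProj_natCast, DirectSum.decompose_of_mem_same _ ha]

theorem intProj_of_mem_ne {m n : ℤ} {a : A} (ha : a ∈ component 𝒜 n) (hmn : m ≠ n) :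
    intProj 𝒜 m a = 0 := by
  rcases lt_or_ge n 0 with hn | hn
  · rw [eq_zero_of_mem_component hn ha, map_zero]
  rcases lt_or_ge m 0 with hm | hm
  · rw [intProj_of_neg 𝒜 hm]
  lift n to ℕ using hn
  lift m to ℕ using hm
  rw [component_natCast] at ha
  rw [intProj_natCast, DirectSum.decompose_of_mem_ne _ ha]
  exact fun h => hmn (by rw [h])

theorem intProj_induction {motive : A → Prop} (zero : motive 0)
    (hom : ∀ (n : ℕ) (a : A), a ∈ 𝒜 n → motive a)
    (add : ∀ a b, motive a → motive b → motive (a + b)) (a : A) : motive a :=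
  DirectSum.Decomposition.inductionOn 𝒜 zero (fun {i} m => hom i m m.2) (fun m m' => add m m') a

/-- With degrees in `ℤ` and zero components below 0, the shift by `p` needs no side condition
comparing degrees. -/
theorem intProj_mul_left {p : ℤ} {a : A} (ha : a ∈ component 𝒜 p) (q : ℤ) (b : A) :
    intProj 𝒜 (p + q) (a * b) = a * intProj 𝒜 q b := by
  induction b using intProj_induction (𝒜 := 𝒜) with
  | zero => simp
  | add b c hb hc => rw [mul_add, map_add, hb, hc, map_add, mul_add]
  | hom n b hb =>
    rw [← component_natCast 𝒜] at hb
    by_cases hq : q = n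
    · rw [hq, intProj_of_mem (mul_mem_component 𝒜 ha hb), intProj_of_mem hb]
    · rw [intProj_of_mem_ne (mul_mem_component 𝒜 ha hb) (by omega), intProj_of_mem_ne hb hq,
        mul_zero]

theorem intProj_mul_right {q : ℤ} {b : A} (hb : b ∈ component 𝒜 q) (p : ℤ) (a : A) :
    intProj 𝒜 (p + q) (a * b) = intProj 𝒜 p a * b := by
  induction a using intProj_induction (𝒜 := 𝒜) with
  | zero => simp
  | add a c ha hc => rw [add_mul, map_add, ha, hc, map_add, add_mul]
  | hom n a ha =>
    rw [← component_natCast 𝒜] at ha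
    by_cases hp : p = n
    · rw [hp, intProj_of_mem (mul_mem_component 𝒜 ha hb), intProj_of_mem ha]
    · rw [intProj_of_mem_ne (mul_mem_component 𝒜 ha hb) (by omega), intProj_of_mem_ne ha hp,
        zero_mul]

/-! ### The augmentation ideal -/

theorem mem_augmentationIdeal {a : A} : a ∈ augmentationIdeal 𝒜 ↔ intProj 𝒜 0 a = 0 := by
  rw [intProj_zero, ← GradedRing.projZeroRingHom_apply]
  rfl

theorem mul_mem_augmentationIdeal (a : A) {b : A} (hb : b ∈ augmentationIdeal 𝒜) :
    a * b ∈ augmentationIdeal 𝒜 := by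
  rw [mem_augmentationIdeal, intProj_zero, ← GradedRing.projZeroRingHom_apply] at hb ⊢
  rw [map_mul, hb, mul_zero]

theorem mem_augmentationIdeal_of_mem_component {n : ℤ} (hn : n ≠ 0) {a : A}
    (ha : a ∈ component 𝒜 n) : a ∈ augmentationIdeal 𝒜 :=
  mem_augmentationIdeal.2 (intProj_of_mem_ne ha hn.symm)

/-- This is the degree test for minimal complexes: a matrix entry of the differential vanishes
unless the degree strictly increases. -/
theorem eq_zero_of_mem_component_of_mem_augmentationIdeal {n : ℤ} (hn : n ≤ 0) {a : A}
    (ha : a ∈ component 𝒜 n) (ha' : a ∈ augmentationIdeal 𝒜) : a = 0 := by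
  rcases hn.lt_or_eq with hn | rfl
  · exact eq_zero_of_mem_component hn ha
  · rw [← intProj_of_mem ha, mem_augmentationIdeal.1 ha']

theorem smul_mem_augmentationIdeal (c : K) {a : A} (ha : a ∈ augmentationIdeal 𝒜) :
    c • a ∈ augmentationIdeal 𝒜 := by
  rw [mem_augmentationIdeal] at ha ⊢
  rw [map_smul, ha, smul_zero]

theorem one_notMem_augmentationIdeal [Nontrivial A] : (1 : A) ∉ augmentationIdeal 𝒜 := by
  rw [mem_augmentationIdeal, intProj_of_mem (one_mem_component 𝒜)]
  exact one_ne_zero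

theorem eq_zero_of_smul_one_mem_augmentationIdeal [Nontrivial A] {c : K}
    (hc : c • (1 : A) ∈ augmentationIdeal 𝒜) : c = 0 := by
  by_contra h
  apply one_notMem_augmentationIdeal (𝒜 := 𝒜)
  simpa [smul_smul, h] using smul_mem_augmentationIdeal c⁻¹ hc

/-- In an algebra generated in degree one, `Aₙ₊₁ = A₁ Aₙ`. -/
theorem IsStandardGraded.mem_mul (h𝒜 : IsStandardGraded 𝒜) {n : ℕ} {a : A}
    (ha : a ∈ 𝒜 (n + 1)) : a ∈ 𝒜 1 * 𝒜 n := by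
  have hle : ∀ m, (𝒜 1) ^ m ≤ 𝒜 m := by
    intro m
    induction m with
    | zero => rw [pow_zero, h𝒜.connected]
    | succ m ih =>
      rw [pow_succ, Submodule.mul_le]
      exact fun x hx y hy => SetLike.mul_mem_graded (ih hx) hy
  have key : ∀ x : A, ∀ m : ℕ, intProj 𝒜 m x ∈ (𝒜 1) ^ m := by
    intro x
    have hx : x ∈ Algebra.adjoin K (𝒜 1 : Set A) := by rw [h𝒜.generated]; trivial
    have hx' : x ∈ ⨆ m : ℕ, (𝒜 1) ^ m := by
      induction hx using Algebra.adjoin_induction with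
      | mem x hx => exact Submodule.mem_iSup_of_mem 1 (by simpa using hx)
      | algebraMap r =>
        exact Submodule.mem_iSup_of_mem 0 (by simp)
      | add x y _ _ hx hy => exact add_mem hx hy
      | mul x y _ _ hx hy =>
        have h := Submodule.mul_mem_mul hx hy
        simp only [Submodule.iSup_mul, Submodule.mul_iSup, ← pow_add] at h
        refine SetLike.le_def.1 ?_ h
        exact iSup_le fun i => iSup_le fun j => le_iSup (fun m => (𝒜 1) ^ m) _
    refine Submodule.iSup_induction _ (motive := fun x => ∀ m : ℕ, intProj 𝒜 m x ∈ (𝒜 1) ^ m) hx'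
      ?_ ?_ ?_
    · intro i y hy m
      have hy' := hle i hy
      rw [← component_natCast 𝒜] at hy'
      by_cases h : m = i
      · subst h
        rwa [intProj_of_mem hy']
      · rw [intProj_of_mem_ne hy' (by exact_mod_cast h)]
        exact zero_mem _
    · intro m
      rw [map_zero]
      exact zero_mem _
    · intro y z hy hz m
      rw [map_add]
      exact add_mem (hy m) (hz m)
  have h := key a (n + 1)
  rw [← component_natCast 𝒜] at ha
  rw [intProj_of_mem ha, pow_succ'] at h
  exact mul_le_mul_right (hle n) (𝒜 1) h

end Components

/-! ### Free right modules -/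

section Free

variable {A : Type*} [Ring A] {ι κ M : Type*} [AddCommGroup M] [Module Aᵐᵒᵖ M]

/-- The map of right modules out of the free right module with prescribed values on the basis. -/
def freeLift (v : ι → M) : (ι →₀ A) →ₗ[Aᵐᵒᵖ] M where
  toFun x := x.sum fun t a => op a • v t
  map_add' x y := by
    classical
    exact Finsupp.sum_add_index' (by simp) (by simp [add_smul])
  map_smul' c x := by
    rw [Finsupp.sum_smul_index' (by simp), Finsupp.smul_sum]
    simp [Finsupp.sum, mul_smul, MulOpposite.smul_eq_mul_unop]

@[simp]
theorem freeLift_single (v : ι → M) (t : ι) (a : A) :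
    freeLift v (Finsupp.single t a) = op a • v t := by
  simp [freeLift]

theorem single_eq_smul (t : ι) (a : A) :
    (Finsupp.single t a : ι →₀ A) = op a • Finsupp.single t 1 := by
  simp

theorem map_eq_sum (φ : (ι →₀ A) →ₗ[Aᵐᵒᵖ] M) (x : ι →₀ A) :
    φ x = x.sum fun t a => op a • φ (Finsupp.single t 1) := by
  conv_lhs => rw [← Finsupp.sum_single x]
  rw [Finsupp.sum, map_sum]
  refine Finset.sum_congr rfl fun t _ => ?_
  rw [single_eq_smul, map_smul]

theorem map_eq_sum_mul (f : (ι →₀ A) →ₗ[Aᵐᵒᵖ] A) (x : ι →₀ A) :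
    f x = x.sum fun t a => f (Finsupp.single t 1) * a :=
  map_eq_sum f x

theorem map_apply_eq_sum_mul (φ : (ι →₀ A) →ₗ[Aᵐᵒᵖ] (κ →₀ A)) (x : ι →₀ A) (s : κ) :
    φ x s = x.sum fun t a => φ (Finsupp.single t 1) s * a :=
  map_eq_sum (Finsupp.lapply s ∘ₗ φ) x

theorem hom_ext_single {f g : (ι →₀ A) →ₗ[Aᵐᵒᵖ] M}
    (h : ∀ t, f (Finsupp.single t 1) = g (Finsupp.single t 1)) : f = g := by
  refine LinearMap.ext fun x => ?_
  rw [map_eq_sum f, map_eq_sum g]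
  simp only [h]

instance projective_finsupp : Module.Projective Aᵐᵒᵖ (ι →₀ A) := by
  refine Module.Projective.of_lifting_property'' fun f hf => ?_
  choose v hv using fun t : ι => hf (Finsupp.single t 1)
  exact ⟨freeLift v, hom_ext_single fun t => by simp [hv]⟩

end Free

/-! ### Minimal resolutions and global dimension -/

section Nakayama

variable {K A : Type*} [Field K] [Ring A] [Algebra K A] {𝒜 : ℕ → Submodule K A} [GradedAlgebra 𝒜]

/-- Multiplying by `A₊` raises the order of vanishing by one, which is the inductive step of graded
Nakayama. -/
theorem intProj_mul_eq_zero {a b : A} (ha : a ∈ augmentationIdeal 𝒜) {n : ℕ}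
    (hb : ∀ k < n, intProj 𝒜 (k : ℤ) b = 0) (k : ℕ) (hk : k < n + 1) :
    intProj 𝒜 (k : ℤ) (a * b) = 0 := by
  rw [mem_augmentationIdeal, intProj_zero, ZeroMemClass.coe_eq_zero] at ha
  simp only [intProj_natCast, ZeroMemClass.coe_eq_zero] at hb ⊢
  rw [DirectSum.decompose_mul]
  refine mul_apply_eq_zero (m := 1) (n := n) (fun i hi => ?_) (fun i hi => hb i hi) ?_
  · obtain rfl : i = 0 := by omega
    exact ha
  · omega

theorem eq_zero_of_forall_intProj {a : A} (h : ∀ k : ℕ, intProj 𝒜 (k : ℤ) a = 0) : a = 0 := by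
  apply (DirectSum.decompose 𝒜).injective
  rw [DirectSum.decompose_zero]
  ext k
  simpa [intProj_natCast] using h k

/-- A surjection from a free module onto a projective module, with kernel inside `F A₊`, is
injective. -/
theorem ker_eq_bot_of_projective {ι M : Type*} [AddCommGroup M] [Module Aᵐᵒᵖ M]
    [Module.Projective Aᵐᵒᵖ M] (p : (ι →₀ A) →ₗ[Aᵐᵒᵖ] M) (hp : Function.Surjective p)
    (hker : ∀ x, p x = 0 → ∀ s, x s ∈ augmentationIdeal 𝒜) : LinearMap.ker p = ⊥ := by
  obtain ⟨σ, hσ⟩ := Module.projective_lifting_property p LinearMap.id hp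
  have hσ' : ∀ y, p (σ y) = y := fun y => LinearMap.congr_fun hσ y
  -- Projection onto the kernel along the splitting. Its matrix has entries in `A₊` and it fixes
  -- kernel elements, so writing `x = π x` repeatedly pushes the coordinates of `x` into ever higher
  -- degrees.
  let π : (ι →₀ A) →ₗ[Aᵐᵒᵖ] (ι →₀ A) := LinearMap.id - σ ∘ₗ p
  have hπ : ∀ x, p (π x) = 0 := fun x => by simp [π, hσ']
  have key : ∀ n : ℕ, ∀ x, p x = 0 → ∀ s, ∀ k < n, intProj 𝒜 (k : ℤ) (x s) = 0 := by
    intro n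
    induction n with
    | zero => intro x _ s k hk; omega
    | succ n ih =>
      intro x hx s k hk
      have hxπ : π x = x := by simp [π, hx]
      rw [← hxπ, map_apply_eq_sum_mul, Finsupp.sum, map_sum]
      exact Finset.sum_eq_zero fun t _ =>
        intProj_mul_eq_zero (hker _ (hπ _) s) (fun k hk => ih x hx t k hk) k hk
  rw [LinearMap.ker_eq_bot']
  intro x hx
  ext s
  exact eq_zero_of_forall_intProj (𝒜 := 𝒜) fun k => key (k + 1) x hx s k (by omega)

end Nakayama

namespace GradedFreeResolution

variable {K A : Type*} [Field K] [Ring A] [Algebra K A] {𝒜 : ℕ → Submodule K A} [GradedAlgebra 𝒜]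
  {P : GradedFreeResolution 𝒜}

theorem d_comp_d (i : ℕ) (x) : P.d i (P.d (i + 1) x) = 0 :=
  (P.exact i _).2 ⟨x, rfl⟩

theorem IsMinimal.mem_of_d_eq_zero (hP : P.IsMinimal) {i : ℕ} {x : P.ι (i + 1) →₀ A}
    (hx : P.d i x = 0) (s : P.ι (i + 1)) : x s ∈ augmentationIdeal 𝒜 := by
  obtain ⟨y, rfl⟩ := (P.exact i x).1 hx
  exact hP _ y s

theorem IsMinimal.mem_of_ε_eq_zero (hP : P.IsMinimal) {x : P.ι 0 →₀ A}
    (hx : P.ε x = 0) (s : P.ι 0) : x s ∈ augmentationIdeal 𝒜 := by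
  obtain ⟨y, rfl⟩ := (P.exact_zero x).1 hx
  exact hP _ y s

/-- If the differential vanishes, each basis vector is a cycle, hence a boundary, and minimality
would put 1 in `A₊`. -/
theorem IsMinimal.isEmpty_of_d_eq_zero [Nontrivial A] (hP : P.IsMinimal) {i : ℕ}
    (h : P.d i = 0) : IsEmpty (P.ι (i + 1)) := by
  refine ⟨fun t => one_notMem_augmentationIdeal (𝒜 := 𝒜) ?_⟩
  have := hP.mem_of_d_eq_zero (i := i) (x := Finsupp.single t 1) (by simp [h]) t
  simpa using this

theorem IsMinimal.isEmpty_of_lt [Nontrivial A] (hP : P.IsMinimal) {d : ℕ} (h : P.d d = 0)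
    {i : ℕ} (hi : d < i) : IsEmpty (P.ι i) := by
  induction i, hi using Nat.le_induction with
  | base => exact hP.isEmpty_of_d_eq_zero h
  | succ i hi ih => exact hP.isEmpty_of_d_eq_zero (Subsingleton.elim _ _)

/-- Projective dimensions drop along the syzygies of a projective presentation. -/
theorem _root_.MonotonicAlg.hasProjectiveDimensionLT_ker.{u} {R : Type u} [Ring R] {M N : Type u}
    [AddCommGroup M] [Module R M] [AddCommGroup N] [Module R N] [Module.Projective R M]
    {f : M →ₗ[R] N} (hf : Function.Surjective f) {Z : Submodule R M} (hZ : LinearMap.ker f = Z)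
    {n : ℕ}
    (h : HasProjectiveDimensionLT (ModuleCat.of R N) (n + 2)) :
    HasProjectiveDimensionLT (ModuleCat.of R Z) (n + 1) := by
  subst hZ
  have hM : Projective (ModuleCat.of R M) := by
    rw [← IsProjective.iff_projective]; infer_instance
  exact ((LinearMap.shortExact_shortComplexKer hf).hasProjectiveDimensionLT_X₃_iff n hM).1 h

/-- Dimension shifting makes the `d`-th syzygy projective. Its minimal cover by `P_d` is then
injective, so the image of `P_{d+1}`, which is the kernel of that cover, is zero. -/
theorem IsMinimal.d_eq_zero.{u} {A : Type u} [Ring A] [Algebra K A] {𝒜 : ℕ → Submodule K A}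
    [GradedAlgebra 𝒜] {P : GradedFreeResolution 𝒜} (hP : P.IsMinimal) {d : ℕ}
    (hd : rightGlobalDimension A = d) : P.d d = 0 := by
  have h0 : HasProjectiveDimensionLT (ModuleCat.of Aᵐᵒᵖ (TrivialModule 𝒜)) (d + 1) := by
    have := (projectiveDimension_le_iff (ModuleCat.of Aᵐᵒᵖ (TrivialModule 𝒜)) d).1 (by
      rw [← hd]
      exact le_iSup (fun M : ModuleCat.{u} Aᵐᵒᵖ => projectiveDimension M) _)
    exact this
  cases d with
  | zero =>
    have hproj : Module.Projective Aᵐᵒᵖ (TrivialModule 𝒜) :=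
      (IsProjective.iff_projective _).2 (projective_iff_hasProjectiveDimensionLT_one.2 h0)
    have hker := ker_eq_bot_of_projective (𝒜 := 𝒜) P.ε P.ε_surjective
      (fun x hx => hP.mem_of_ε_eq_zero hx)
    refine LinearMap.ext fun x => ?_
    rw [LinearMap.ker_eq_bot'] at hker
    exact hker _ ((P.exact_zero _).2 ⟨x, rfl⟩)
  | succ d =>
    have hrange : ∀ i, LinearMap.range (P.d (i + 1)) = LinearMap.ker (P.d i) := fun i =>
      (P.exact i).linearMap_ker_eq.symm
    have hrange0 : LinearMap.range (P.d 0) = LinearMap.ker P.ε :=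
      P.exact_zero.linearMap_ker_eq.symm
    have step : ∀ i n, i + n = d →
        HasProjectiveDimensionLT (ModuleCat.of Aᵐᵒᵖ (LinearMap.range (P.d i))) (n + 1) := by
      intro i
      induction i with
      | zero =>
        intro n hn
        obtain rfl : n = d := by omega
        exact hasProjectiveDimensionLT_ker P.ε_surjective hrange0.symm h0
      | succ i ih =>
        intro n hn
        exact hasProjectiveDimensionLT_ker (LinearMap.surjective_rangeRestrict (P.d i))
          ((LinearMap.ker_rangeRestrict _).trans (hrange i).symm) (ih (n + 1) (by omega))
    have hproj : Module.Projective Aᵐᵒᵖ (LinearMap.range (P.d d)) :=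
      (IsProjective.iff_projective _).2
        (projective_iff_hasProjectiveDimensionLT_one.2 (step d 0 rfl))
    have hmem : ∀ x, (P.d d).rangeRestrict x = 0 → ∀ s, x s ∈ augmentationIdeal 𝒜 := by
      intro x hx
      rw [Subtype.ext_iff] at hx
      exact hP.mem_of_d_eq_zero hx
    have hker := ker_eq_bot_of_projective (A := A) (ι := P.ι (d + 1))
      (M := LinearMap.range (P.d d)) _ (LinearMap.surjective_rangeRestrict (P.d d)) hmem
    rw [LinearMap.ker_rangeRestrict, LinearMap.ker_eq_bot'] at hker
    exact LinearMap.ext fun x => hker _ (d_comp_d d x)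

/-! ### Degrees and ranks in minimal resolutions -/

/-- In a minimal resolution, every generator of `Pᵢ₊₁` has larger degree than some generator
of `Pᵢ`. -/
theorem IsMinimal.exists_deg_lt [Nontrivial A] (hP : P.IsMinimal) {i : ℕ} (t : P.ι (i + 1)) :
    ∃ s, P.deg i s < P.deg (i + 1) t := by
  by_contra! h
  apply one_notMem_augmentationIdeal (𝒜 := 𝒜)
  have h0 : P.d i (Finsupp.single t 1) = 0 := by
    ext s
    exact eq_zero_of_mem_component_of_mem_augmentationIdeal (by linarith [h s])
      (P.d_homogeneous i t s) (hP _ _ _)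
  simpa using hP.mem_of_d_eq_zero h0 t

/-- A `K`-linear relation among the images of the basis is a kernel element with scalar coordinates,
and `A₊` contains no nonzero scalar. -/
theorem _root_.MonotonicAlg.linearIndependent_of_ker [Nontrivial A] {ι M : Type*} [AddCommGroup M]
    [Module K M] [Module Aᵐᵒᵖ M] [IsScalarTower K Aᵐᵒᵖ M] (φ : (ι →₀ A) →ₗ[Aᵐᵒᵖ] M)
    (hφ : ∀ x, φ x = 0 → ∀ s, x s ∈ augmentationIdeal 𝒜) :
    LinearIndependent K fun s => φ (Finsupp.single s 1) := by
  rw [linearIndependent_iff]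
  intro c hc
  have hx : φ (c.mapRange (fun k => k • (1 : A)) (zero_smul K 1)) = 0 := by
    rw [map_eq_sum, Finsupp.sum_mapRange_index (by simp), ← hc, Finsupp.linearCombination_apply]
    refine Finsupp.sum_congr fun s _ => ?_
    rw [op_smul, op_one, smul_assoc, one_smul]
  ext s
  have := hφ _ hx s
  rw [Finsupp.mapRange_apply] at this
  exact eq_zero_of_smul_one_mem_augmentationIdeal this

theorem _root_.MonotonicAlg.finite_of_ker [Nontrivial A] {ι M : Type*} [AddCommGroup M]
    [Module K M] [Module Aᵐᵒᵖ M] [IsScalarTower K Aᵐᵒᵖ M] (φ : (ι →₀ A) →ₗ[Aᵐᵒᵖ] M)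
    (hφ : ∀ x, φ x = 0 → ∀ s, x s ∈ augmentationIdeal 𝒜) (V : Submodule K M)
    [FiniteDimensional K V] (hV : ∀ s, φ (Finsupp.single s 1) ∈ V) : Finite ι := by
  have h := linearIndependent_of_ker (K := K) φ hφ
  let v : ι → V := fun s => ⟨φ (Finsupp.single s 1), hV s⟩
  have hv : LinearIndependent K v := LinearIndependent.of_comp V.subtype h
  exact hv.finite

end GradedFreeResolution

/-! ### Existence of minimal resolutions -/

section MinimalGenerators

/-- Meant for `N` a graded piece of a submodule and `D` its decomposable part: the basis of the
complement supplies the new generators in that degree. -/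
theorem exists_complement_basis {K V : Type*} [Field K] [AddCommGroup V] [Module K V]
    {D N : Submodule K V} [FiniteDimensional K N] (h : D ≤ N) :
    ∃ (r : ℕ) (b : Fin r → V), LinearIndependent K b ∧ (∀ j, b j ∈ N) ∧
      D ⊔ Submodule.span K (Set.range b) = N ∧ Disjoint D (Submodule.span K (Set.range b)) := by
  obtain ⟨C, hd, hs⟩ := IsModularLattice.exists_disjoint_and_sup_eq h
  have hC : C ≤ N := hs ▸ le_sup_right
  have : FiniteDimensional K C := Submodule.finiteDimensional_of_le hC
  let b := Module.finBasis K C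
  have hspan : Submodule.span K (Set.range fun j => (b j : V)) = C := by
    have := congrArg (Submodule.map C.subtype) b.span_eq
    rw [Submodule.map_span, ← Set.range_comp, Submodule.map_subtype_top] at this
    exact this
  exact ⟨_, fun j => b j, b.linearIndependent.map' C.subtype C.ker_subtype,
    fun j => hC (b j).2, by rw [hspan, hs], by rwa [hspan]⟩

variable {K A : Type*} [Field K] [Ring A] [Algebra K A] (𝒜 : ℕ → Submodule K A)
  {ι κ : Type*} (deg : ι → ℕ)

/-- The homogeneous elements of degree `n` of the free graded right module on generators of the
given degrees. -/
noncomputable def degreePart (n : ℕ) : Submodule K (ι →₀ A) where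
  carrier := {x | ∀ s, x s ∈ component 𝒜 ((n : ℤ) - deg s)}
  add_mem' hx hy s := add_mem (hx s) (hy s)
  zero_mem' _ := zero_mem _
  smul_mem' c _ hx s := (component 𝒜 _).smul_mem c (hx s)

variable {𝒜 deg} in
theorem finiteDimensional_degreePart [∀ n, FiniteDimensional K (𝒜 n)]
    (hfin : ∀ n : ℕ, {s | deg s ≤ n}.Finite) (n : ℕ) :
    FiniteDimensional K (degreePart 𝒜 deg n) := by
  have : Finite {s // deg s ≤ n} := (hfin n).to_subtype
  let f : degreePart 𝒜 deg n →ₗ[K] ∀ s : {s // deg s ≤ n}, component 𝒜 ((n : ℤ) - deg s) :=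
    { toFun := fun x s => ⟨x.1 s, x.2 s⟩
      map_add' := fun _ _ => rfl
      map_smul' := fun _ _ => rfl }
  have : FiniteDimensional K (∀ s : {s // deg s ≤ n}, component 𝒜 ((n : ℤ) - deg s)) :=
    FiniteDimensional.finiteDimensional_pi' K _
  refine FiniteDimensional.of_injective f ?_
  rw [injective_iff_map_eq_zero]
  intro x hx
  ext s
  by_cases hs : deg s ≤ n
  · exact congrArg Subtype.val (congrFun hx ⟨s, hs⟩)
  · exact eq_zero_of_mem_component (by omega) (x.2 s)

variable [GradedAlgebra 𝒜]

/-- The projection onto the component of degree `n` of a free graded right module. -/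
noncomputable def degProj (n : ℕ) : (ι →₀ A) →ₗ[K] (ι →₀ A) :=
  Finsupp.lsum K fun s => Finsupp.lsingle s ∘ₗ intProj 𝒜 ((n : ℤ) - deg s)

@[simp]
theorem degProj_apply (n : ℕ) (x : ι →₀ A) (s : ι) :
    degProj 𝒜 deg n x s = intProj 𝒜 ((n : ℤ) - deg s) (x s) := by
  classical
  induction x using Finsupp.induction_linear with
  | zero => simp
  | add x y hx hy => simp [hx, hy]
  | single t a =>
    simp only [degProj, Finsupp.lsum_single, LinearMap.comp_apply, Finsupp.lsingle_apply,
      Finsupp.single_apply]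
    split_ifs with h
    · rw [h]
    · simp

theorem degProj_mem (n : ℕ) (x : ι →₀ A) : degProj 𝒜 deg n x ∈ degreePart 𝒜 deg n := by
  intro s
  rw [degProj_apply]
  exact intProj_mem 𝒜 _ _

variable {𝒜 deg}

theorem degProj_of_mem {n : ℕ} {x : ι →₀ A} (hx : x ∈ degreePart 𝒜 deg n) :
    degProj 𝒜 deg n x = x := by
  ext s
  rw [degProj_apply, intProj_of_mem (hx s)]

/-- Asking for all large `m`, not just one, lets the bounds of two summands be combined by a
maximum. -/
theorem exists_sum_degProj (x : ι →₀ A) :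
    ∃ M : ℕ, ∀ m ≥ M, ∑ n ∈ Finset.range m, degProj 𝒜 deg n x = x := by
  induction x using Finsupp.induction_linear with
  | zero => exact ⟨0, by simp⟩
  | add x y hx hy =>
    obtain ⟨M, hM⟩ := hx
    obtain ⟨M', hM'⟩ := hy
    refine ⟨max M M', fun m hm => ?_⟩
    simp only [map_add, Finset.sum_add_distrib]
    rw [hM m (le_of_max_le_left hm), hM' m (le_of_max_le_right hm)]
  | single s a =>
    induction a using intProj_induction (𝒜 := 𝒜) with
    | zero => exact ⟨0, by simp⟩
    | add a b ha hb =>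
      obtain ⟨M, hM⟩ := ha
      obtain ⟨M', hM'⟩ := hb
      refine ⟨max M M', fun m hm => ?_⟩
      simp only [Finsupp.single_add, map_add, Finset.sum_add_distrib]
      rw [hM m (le_of_max_le_left hm), hM' m (le_of_max_le_right hm)]
    | hom k a ha =>
      rw [← component_natCast 𝒜] at ha
      refine ⟨k + deg s + 1, fun m hm => ?_⟩
      rw [Finset.sum_eq_single (k + deg s)]
      · simp [degProj, intProj_of_mem ha]
      · intro n _ hn
        simp [degProj, intProj_of_mem_ne ha (m := (n : ℤ) - deg s) (by omega)]
      · intro h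
        simp at h
        omega

theorem mem_of_forall_degProj_mem {S : Type*} [SetLike S (ι →₀ A)] [AddSubmonoidClass S (ι →₀ A)]
    {N : S} {x : ι →₀ A} (h : ∀ n, degProj 𝒜 deg n x ∈ N) : x ∈ N := by
  obtain ⟨M, hM⟩ := exists_sum_degProj (𝒜 := 𝒜) (deg := deg) x
  rw [← hM M le_rfl]
  exact sum_mem fun n _ => h n

theorem degProj_map {deg' : κ → ℕ} (φ : (κ →₀ A) →ₗ[Aᵐᵒᵖ] (ι →₀ A))
    (hφ : ∀ t s, φ (Finsupp.single t 1) s ∈ component 𝒜 ((deg' t : ℤ) - deg s)) (n : ℕ)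
    (x : κ →₀ A) : degProj 𝒜 deg n (φ x) = φ (degProj 𝒜 deg' n x) := by
  induction x using Finsupp.induction_linear with
  | zero => simp
  | add x y hx hy => simp only [map_add, hx, hy]
  | single t a =>
    ext s
    have h1 : ∀ b : A, φ (Finsupp.single t b) s = φ (Finsupp.single t 1) s * b := by
      intro b
      rw [single_eq_smul, map_smul]
      rfl
    have h2 : degProj 𝒜 deg' n (Finsupp.single t a) =
        Finsupp.single t (intProj 𝒜 ((n : ℤ) - deg' t) a) := by
      simp [degProj]
    rw [degProj_apply, h2, h1 a, h1 (intProj 𝒜 _ a), ← intProj_mul_left (hφ t s)]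
    congr 2
    ring

theorem op_smul_mem_degreePart {m n : ℕ} {x : ι →₀ A} {a : A} (hx : x ∈ degreePart 𝒜 deg m)
    (ha : a ∈ component 𝒜 ((n : ℤ) - m)) : op a • x ∈ degreePart 𝒜 deg n := by
  intro s
  have := mul_mem_component 𝒜 (hx s) ha
  rwa [sub_add_sub_comm, add_comm (m : ℤ), add_sub_add_right_eq_sub] at this

/-- A homogeneous submodule of a locally finite graded free module has a minimal system of
homogeneous generators. -/
theorem exists_minimal_generators (h𝒜 : IsStandardGraded 𝒜)
    (hfin : ∀ n : ℕ, {s | deg s ≤ n}.Finite) (N : Submodule Aᵐᵒᵖ (ι →₀ A))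
    (hN : ∀ x ∈ N, ∀ n, degProj 𝒜 deg n x ∈ N) :
    ∃ (κ : Type) (deg' : κ → ℕ) (φ : (κ →₀ A) →ₗ[Aᵐᵒᵖ] (ι →₀ A)),
      (∀ n : ℕ, {t | deg' t ≤ n}.Finite) ∧
      (∀ t s, φ (Finsupp.single t 1) s ∈ component 𝒜 ((deg' t : ℤ) - deg s)) ∧
      LinearMap.range φ = N ∧ ∀ x, φ x = 0 → ∀ t, x t ∈ augmentationIdeal 𝒜 := by
  have := h𝒜.nontrivial
  have := h𝒜.locallyFinite
  have := fun n => finiteDimensional_degreePart (𝒜 := 𝒜) hfin n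
  let V : ℕ → Submodule K (ι →₀ A) := fun n => degreePart 𝒜 deg n ⊓ N.restrictScalars K
  -- The degree `n` part of `N A₊`, generated by the pieces of `N` in lower degrees.
  let D : ℕ → Submodule K (ι →₀ A) := fun n =>
    Submodule.span K {y | ∃ m < n, ∃ x ∈ V m, ∃ a ∈ component 𝒜 ((n : ℤ) - m), y = op a • x}
  have hDV : ∀ n, D n ≤ V n := by
    intro n
    refine Submodule.span_le.2 ?_
    rintro y ⟨m, -, x, hx, a, ha, rfl⟩
    exact ⟨op_smul_mem_degreePart hx.1 ha, N.smul_mem _ hx.2⟩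
  have hVfin : ∀ n, FiniteDimensional K (V n) := fun n =>
    Submodule.finiteDimensional_of_le (S₂ := degreePart 𝒜 deg n) inf_le_left
  choose r b hli hbV hsup hdisj using fun n => exists_complement_basis (hDV n)
  let κ : Type := Σ n : ℕ, Fin (r n)
  let φ : (κ →₀ A) →ₗ[Aᵐᵒᵖ] (ι →₀ A) := freeLift fun t : κ => b t.1 t.2
  have hφ1 : ∀ t : κ, φ (Finsupp.single t 1) = b t.1 t.2 := fun t => by
    simp [φ]
  have hφV : ∀ t : κ, φ (Finsupp.single t 1) ∈ V t.1 := fun t => by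
    rw [hφ1]
    exact hbV _ _
  have hφhom : ∀ t s, φ (Finsupp.single t 1) s ∈ component 𝒜 ((t.1 : ℤ) - deg s) :=
    fun t s => (hφV t).1 s
  have hrange : LinearMap.range φ = N := by
    apply le_antisymm
    · rintro _ ⟨x, rfl⟩
      rw [map_eq_sum]
      exact sum_mem fun t _ => N.smul_mem _ (hφV t).2
    · have hV : ∀ n, V n ≤ (LinearMap.range φ).restrictScalars K := by
        intro n
        induction n using Nat.strong_induction_on with
        | _ n ih =>
          rw [← hsup n]
          refine sup_le (Submodule.span_le.2 ?_) (Submodule.span_le.2 ?_)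
          · rintro y ⟨m, hm, x, hx, a, -, rfl⟩
            exact (LinearMap.range φ).smul_mem _ (ih m hm hx)
          · rintro _ ⟨j, rfl⟩
            exact ⟨Finsupp.single ⟨n, j⟩ 1, hφ1 ⟨n, j⟩⟩
      intro x hx
      exact mem_of_forall_degProj_mem (𝒜 := 𝒜) (deg := deg) fun n =>
        hV n ⟨degProj_mem 𝒜 deg n x, hN x hx n⟩
  refine ⟨κ, Sigma.fst, φ, ?_, hφhom, hrange, ?_⟩
  · intro n
    have : {t : κ | t.1 ≤ n} = ⋃ m ∈ Set.Iic n, Set.range (Sigma.mk m) := by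
      ext ⟨m, j⟩
      simp only [Set.mem_ofPred_eq, Set.mem_iUnion, Set.mem_Iic, Set.mem_range]
      constructor
      · exact fun h => ⟨m, h, j, rfl⟩
      · rintro ⟨m', h, j', hj⟩
        cases hj
        exact h
    rw [this]
    exact (Set.finite_Iic n).biUnion fun m _ => Set.finite_range _
  · intro x hx t
    obtain ⟨n, j₀⟩ := t
    -- The generator `⟨n, j₀⟩` has degree `n`, so the degree 0 component of its coordinate in `x` is
    -- its coordinate in `y`; it suffices to show that this scalar is zero.
    let y := degProj 𝒜 (Sigma.fst : κ → ℕ) n x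
    have hy : φ y = 0 := by rw [← degProj_map φ hφhom, hx, map_zero]
    have hy' : ∀ j, ∃ c : K, y ⟨n, j⟩ = c • 1 := by
      intro j
      refine h𝒜.exists_smul_one ?_
      have := degProj_mem 𝒜 (Sigma.fst : κ → ℕ) n x ⟨n, j⟩
      rwa [sub_self] at this
    choose c hc using hy'
    let z : κ →₀ A := ∑ j, Finsupp.single ⟨n, j⟩ (c j • 1)
    have hz : φ z = ∑ j, c j • b n j := by
      simp only [z, map_sum]
      refine Finset.sum_congr rfl fun j _ => ?_
      rw [single_eq_smul, map_smul, hφ1, op_smul, op_one, smul_assoc, one_smul]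
    -- Subtracting `z` removes the coordinates at generators of degree `n`, and those at higher
    -- generators vanish by degree. Only lower generators remain, so `φ z = -φ (y - z)` lies both in
    -- `D n` and in its complement.
    have hyz : φ (y - z) ∈ D n := by
      rw [map_eq_sum]
      refine sum_mem fun t _ => ?_
      change op ((y - z) t) • φ (Finsupp.single t 1) ∈ D n
      rcases lt_trichotomy t.1 n with ht | ht | ht
      · refine Submodule.subset_span ⟨t.1, ht, _, hφV t, _, ?_, rfl⟩
        have h1 : z t = 0 := by
          simp only [z, Finsupp.finsetSum_apply]
          refine Finset.sum_eq_zero fun j _ => Finsupp.single_eq_of_ne ?_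
          rintro rfl
          exact lt_irrefl _ ht
        rw [Finsupp.sub_apply, h1, sub_zero]
        exact degProj_mem 𝒜 (Sigma.fst : κ → ℕ) n x t
      · have h1 : (y - z) t = 0 := by
          obtain ⟨n', j⟩ := t
          obtain rfl : n' = n := ht
          rw [Finsupp.sub_apply, hc, sub_eq_zero]
          simp only [z, Finsupp.finsetSum_apply]
          rw [Finset.sum_eq_single j]
          · simp
          · intro j' _ hj'
            refine Finsupp.single_eq_of_ne ?_
            intro h
            cases h
            exact hj' rfl
          · simp
        rw [h1, op_zero, zero_smul]
        exact zero_mem _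
      · have h1 : y t = 0 :=
          eq_zero_of_mem_component (by simpa using ht) (degProj_mem 𝒜 (Sigma.fst : κ → ℕ) n x t)
        have h2 : z t = 0 := by
          simp only [z, Finsupp.finsetSum_apply]
          refine Finset.sum_eq_zero fun j _ => Finsupp.single_eq_of_ne ?_
          rintro rfl
          exact lt_irrefl _ ht
        rw [Finsupp.sub_apply, h1, h2, sub_zero, op_zero, zero_smul]
        exact zero_mem _
    have hzC : φ z ∈ Submodule.span K (Set.range (b n)) := by
      rw [hz]
      exact sum_mem fun j _ => Submodule.smul_mem _ _ (Submodule.subset_span ⟨j, rfl⟩)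
    have hzD : φ z ∈ D n := by
      rw [map_sub, hy, zero_sub] at hyz
      simpa using neg_mem hyz
    have hz0 : φ z = 0 := Submodule.disjoint_def.1 (hdisj n) _ hzD hzC
    have hc0 : c j₀ = 0 := Fintype.linearIndependent_iff.1 (hli n) c (by rw [← hz, hz0]) j₀
    rw [mem_augmentationIdeal]
    have h1 := hc j₀
    rw [hc0, zero_smul] at h1
    simpa [y] using h1

end MinimalGenerators

/-! ### Iterating minimal covers of syzygies -/

section Existence

variable {K A : Type*} [Field K] [Ring A] [Algebra K A] (𝒜 : ℕ → Submodule K A) [GradedAlgebra 𝒜]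

/-- A locally finite graded free module together with a homogeneous submodule contained in `F A₊`:
a syzygy in a minimal resolution. -/
structure MinimalSyzygy where
  ι : Type
  deg : ι → ℕ
  finite : ∀ n : ℕ, {s | deg s ≤ n}.Finite
  N : Submodule Aᵐᵒᵖ (ι →₀ A)
  homogeneous : ∀ x ∈ N, ∀ n, degProj 𝒜 deg n x ∈ N
  minimal : ∀ x ∈ N, ∀ s, x s ∈ augmentationIdeal 𝒜

/-- The augmentation ideal as the first syzygy of the trivial module. -/
noncomputable def MinimalSyzygy.augmentation : MinimalSyzygy 𝒜 where
  ι := Unit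
  deg _ := 0
  finite _ := Set.toFinite _
  N := (augmentationIdeal 𝒜).comap (Finsupp.lapply ())
  homogeneous := by
    intro x hx n
    rw [Submodule.mem_comap, Finsupp.lapply_apply] at hx ⊢
    rw [degProj_apply]
    rcases Nat.eq_zero_or_pos n with rfl | hn
    · simp [mem_augmentationIdeal.1 hx]
    · exact mem_augmentationIdeal_of_mem_component (n := ((n : ℤ) - (0 : ℕ))) (by omega)
        (intProj_mem 𝒜 _ _)
  minimal x hx _ := hx

variable {𝒜}

/-- The kernel of a minimal homogeneous cover is again homogeneous and inside `F A₊`, so the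
construction can be repeated. -/
theorem MinimalSyzygy.exists_next (h𝒜 : IsStandardGraded 𝒜) (S : MinimalSyzygy 𝒜) :
    ∃ (S' : MinimalSyzygy 𝒜) (φ : (S'.ι →₀ A) →ₗ[Aᵐᵒᵖ] (S.ι →₀ A)),
      (∀ t s, φ (Finsupp.single t 1) s ∈ component 𝒜 ((S'.deg t : ℤ) - S.deg s)) ∧
      LinearMap.range φ = S.N ∧ LinearMap.ker φ = S'.N := by
  obtain ⟨κ, deg', φ, hfin, hφ, hrange, hker⟩ :=
    exists_minimal_generators h𝒜 S.finite S.N S.homogeneous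
  refine ⟨⟨κ, deg', hfin, LinearMap.ker φ, ?_, fun x hx => hker x hx⟩, φ, hφ, hrange, rfl⟩
  intro x hx n
  rw [LinearMap.mem_ker] at hx ⊢
  rw [← degProj_map φ hφ, hx, map_zero]

/-- The trivial module has a minimal graded free resolution in which every `Pᵢ` has finitely many
generators in each degree, and `P₀ = A`. -/
theorem exists_minimal_resolution (h𝒜 : IsStandardGraded 𝒜) :
    ∃ P : GradedFreeResolution 𝒜, P.IsMinimal ∧
      (∀ (i : ℕ) (n : ℤ), {s | P.deg i s ≤ n}.Finite) ∧
      (∃ u : P.ι 0, ∀ s, s = u) ∧ (∀ s, P.deg 0 s = 0) ∧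
      ∀ x : P.ι 0 →₀ A, (∀ s, x s ∈ augmentationIdeal 𝒜) → ∃ y, P.d 0 y = x := by
  choose next φ hφ hrange hker using MinimalSyzygy.exists_next h𝒜
  let S : ℕ → MinimalSyzygy 𝒜 :=
    fun i => Nat.rec (MinimalSyzygy.augmentation 𝒜) (fun _ T => next T) i
  let P : GradedFreeResolution 𝒜 :=
    { ι := fun i => (S i).ι
      deg := fun i s => (S i).deg s
      d := fun i => φ (S i)
      ε := (augmentationIdeal 𝒜).mkQ ∘ₗ Finsupp.lapply ()
      d_homogeneous := fun i t s => hφ (S i) t s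
      ε_homogeneous := fun s hs => absurd rfl hs
      exact := fun i => by
        rw [LinearMap.exact_iff, hker, hrange]
      exact_zero := by
        rw [LinearMap.exact_iff, hrange, LinearMap.ker_comp, Submodule.ker_mkQ]
        rfl
      ε_surjective := by
        intro q
        obtain ⟨a, rfl⟩ := (augmentationIdeal 𝒜).mkQ_surjective q
        exact ⟨Finsupp.single () a, congrArg _ Finsupp.single_eq_same⟩ }
  have hPr : ∀ i, LinearMap.range (P.d i) = (S i).N := fun i => hrange (S i)
  refine ⟨P, ?_, ?_, ⟨(), fun s => rfl⟩, fun s => rfl, ?_⟩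
  · intro i x s
    exact (S i).minimal _ (by rw [← hPr]; exact ⟨x, rfl⟩) s
  · intro i n
    refine ((S i).finite n.toNat).subset fun s hs => ?_
    have : ((S i).deg s : ℤ) ≤ n := hs
    exact this.trans (Int.self_le_toNat n) |> Int.ofNat_le.1
  · intro x hx
    have : x ∈ (S 0).N := hx ()
    rw [← hPr] at this
    exact this

end Existence

namespace GradedFreeResolution

variable {K A : Type*} [Field K] [Ring A] [Algebra K A] {𝒜 : ℕ → Submodule K A} [GradedAlgebra 𝒜]
  {P : GradedFreeResolution 𝒜}

/-! ### Pure resolutions -/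

/-- The images of the basis are independent in the trivial module, which is a line over `K`. -/
theorem IsMinimal.finite_zero (h𝒜 : IsStandardGraded 𝒜) (hP : P.IsMinimal) :
    Finite (P.ι 0) := by
  have := h𝒜.nontrivial
  refine finite_of_ker (𝒜 := 𝒜) P.ε (fun x hx => hP.mem_of_ε_eq_zero hx)
    (Submodule.span K {(augmentationIdeal 𝒜).mkQ 1}) fun s => ?_
  obtain ⟨a, ha⟩ := (augmentationIdeal 𝒜).mkQ_surjective (P.ε (Finsupp.single s 1))
  obtain ⟨c, hc⟩ := h𝒜.exists_smul_one (intProj_mem 𝒜 0 a)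
  refine Submodule.mem_span_singleton.2 ⟨c, ?_⟩
  rw [← ha, Submodule.mkQ_apply, Submodule.mkQ_apply, ← Submodule.Quotient.mk_smul, ← hc,
    Submodule.Quotient.eq, mem_augmentationIdeal, map_sub, intProj_of_mem (intProj_mem 𝒜 0 a),
    sub_self]

/-- By purity all generators of `Pᵢ₊₁` map independently into one graded piece of `Pᵢ`, which is
finite-dimensional when `Pᵢ` has finite rank. -/
theorem IsMinimal.finite_of_pure (h𝒜 : IsStandardGraded 𝒜) (hP : P.IsMinimal)
    (hpure : ∀ i, ∃ a : ℤ, ∀ s, P.deg i s = a) (i : ℕ) : Finite (P.ι i) := by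
  have := h𝒜.nontrivial
  have := h𝒜.locallyFinite
  induction i with
  | zero => exact hP.finite_zero h𝒜
  | succ i ih =>
    obtain ⟨a, ha⟩ := hpure i
    obtain ⟨b, hb⟩ := hpure (i + 1)
    have := finiteDimensional_degreePart (𝒜 := 𝒜) (deg := fun _ : P.ι i => 0)
      (fun _ => Set.toFinite _) (b - a).toNat
    refine finite_of_ker (𝒜 := 𝒜) (P.d i) (fun x hx => hP.mem_of_d_eq_zero hx)
      (degreePart 𝒜 (fun _ : P.ι i => 0) (b - a).toNat) fun t s => ?_
    have h := P.d_homogeneous i t s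
    rw [ha, hb] at h
    rcases lt_or_ge (b - a) 0 with hn | hn
    · rw [eq_zero_of_mem_component hn h]
      exact zero_mem _
    · rwa [Nat.cast_zero, sub_zero, Int.toNat_of_nonneg hn]

theorem IsMinimal.isFiniteOfLength_of_pure (h𝒜 : IsStandardGraded 𝒜) (hP : P.IsMinimal)
    (hpure : ∀ i, ∃ a : ℤ, ∀ s, P.deg i s = a) {d : ℕ} (hd : rightGlobalDimension A = d) :
    P.IsFiniteOfLength d := by
  have := h𝒜.nontrivial
  exact ⟨hP.finite_of_pure h𝒜 hpure, fun i hi => hP.isEmpty_of_lt (hP.d_eq_zero hd) hi⟩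

/-! ### Generators of a minimal resolution in low homological degree -/

theorem IsMinimal.deg_nonneg [Nontrivial A] (hP : P.IsMinimal) (h0 : ∀ s, P.deg 0 s = 0) :
    ∀ i s, 0 ≤ P.deg i s := by
  intro i
  induction i with
  | zero => exact fun s => (h0 s).ge
  | succ i ih =>
    intro t
    obtain ⟨s, hs⟩ := hP.exists_deg_lt t
    exact (ih s).trans hs.le

/-- Projection to degree `n` commutes with the differential. Nonnegativity of the degrees allows
passing to the natural degrees used by `degProj`. -/
theorem exists_homogeneous_preimage (hdeg : ∀ i s, 0 ≤ P.deg i s) {i n : ℕ}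
    {y : P.ι (i + 1) →₀ A} (hy : ∀ s, P.d i y s ∈ component 𝒜 ((n : ℤ) - P.deg i s)) :
    ∃ z, P.d i z = P.d i y ∧ ∀ t, z t ∈ component 𝒜 ((n : ℤ) - P.deg (i + 1) t) := by
  have hcast : ∀ i s, (((P.deg i s).toNat : ℕ) : ℤ) = P.deg i s := fun i s =>
    Int.toNat_of_nonneg (hdeg i s)
  refine ⟨degProj 𝒜 (fun t => (P.deg (i + 1) t).toNat) n y, ?_, fun t => ?_⟩
  · rw [← degProj_map (deg := fun s => (P.deg i s).toNat), degProj_of_mem]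
    · intro s
      rw [hcast]
      exact hy s
    · intro t s
      rw [hcast, hcast]
      exact P.d_homogeneous i t s
  · have := degProj_mem 𝒜 (fun t => (P.deg (i + 1) t).toNat) n y t
    rwa [hcast] at this

theorem eq_single [Unique (P.ι 0)] (x : P.ι 0 →₀ A) : x = Finsupp.single default (x default) :=
  Finsupp.unique_single x

/-- A generator `t` of degree at least 2 would be redundant: its image lies in `A₁ Aₙ`, hence is
already hit using lifts of `A₁`, which have no `t`-coordinate for degree reasons. The difference
would be a cycle with `t`-coordinate 1. -/
theorem IsMinimal.deg_one (h𝒜 : IsStandardGraded 𝒜) (hP : P.IsMinimal) [Unique (P.ι 0)]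
    (h0 : ∀ s, P.deg 0 s = 0)
    (hsurj : ∀ x : P.ι 0 →₀ A, (∀ s, x s ∈ augmentationIdeal 𝒜) → ∃ y, P.d 0 y = x)
    (t : P.ι 1) : P.deg 1 t = 1 := by
  have := h𝒜.nontrivial
  have hpos : 0 < P.deg 1 t := by
    obtain ⟨s, hs⟩ := hP.exists_deg_lt t
    rwa [h0] at hs
  by_contra hne
  obtain ⟨n, hn⟩ : ∃ n : ℕ, P.deg 1 t = ((n + 1 : ℕ) : ℤ) := ⟨(P.deg 1 t).toNat - 1, by omega⟩
  have ha : P.d 0 (Finsupp.single t 1) default ∈ 𝒜 (n + 1) := by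
    have := P.d_homogeneous 0 t default
    rwa [h0, sub_zero, hn, component_natCast] at this
  have key : ∃ y, P.d 0 y = Finsupp.single default (P.d 0 (Finsupp.single t 1) default) ∧
      y t = 0 := by
    refine Submodule.mul_induction_on (C := fun a => ∃ y, P.d 0 y = Finsupp.single default a ∧
      y t = 0) (h𝒜.mem_mul ha) ?_ ?_
    · intro p hp q _
      rw [← component_natCast 𝒜] at hp
      obtain ⟨y, hy⟩ := hsurj (Finsupp.single default p) fun s => by
        rw [Unique.eq_default s, Finsupp.single_eq_same]
        exact mem_augmentationIdeal_of_mem_component (by norm_num) hp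
      obtain ⟨z, hz, hz'⟩ := exists_homogeneous_preimage (hP.deg_nonneg h0) (n := 1) (y := y)
        fun s => by
          rw [hy, Unique.eq_default s, Finsupp.single_eq_same, h0, sub_zero]
          exact hp
      refine ⟨op q • z, ?_, ?_⟩
      · rw [map_smul, hz, hy]
        simp
      · have := eq_zero_of_mem_component (by push_cast at hn ⊢; omega) (hz' t)
        simp [this]
    · rintro a b ⟨y, hy, hy'⟩ ⟨z, hz, hz'⟩
      exact ⟨y + z, by rw [map_add, hy, hz, Finsupp.single_add], by simp [hy', hz']⟩
  obtain ⟨y, hy, hyt⟩ := key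
  rw [← eq_single] at hy
  have hker : P.d 0 (Finsupp.single t 1 - y) = 0 := by rw [map_sub, hy, sub_self]
  have := hP.mem_of_d_eq_zero hker t
  rw [Finsupp.sub_apply, hyt, Finsupp.single_eq_same, sub_zero] at this
  exact one_notMem_augmentationIdeal this

/-! ### The dual complex of a minimal resolution -/

theorem mem_coboundaries {i : ℕ} {n : ℤ} (h : Subsingleton (P.gradedExt i n))
    {f : (P.ι i →₀ A) →ₗ[Aᵐᵒᵖ] A}
    (hf : ∀ s, f (Finsupp.single s 1) ∈ component 𝒜 (n + P.deg i s)) (hf' : f ∘ₗ P.d i = 0) :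
    f ∈ P.coboundaries i n := by
  have hmem : (P.coboundaries i n).mkQ f ∈ P.gradedExt i n := ⟨f, ⟨hf, hf'⟩, rfl⟩
  have h0 : (P.coboundaries i n).mkQ f = 0 :=
    congrArg Subtype.val (Subsingleton.elim (⟨_, hmem⟩ : P.gradedExt i n) 0)
  simpa using h0

theorem exists_of_mem_coboundaries {i : ℕ} {n : ℤ} {f : (P.ι (i + 1) →₀ A) →ₗ[Aᵐᵒᵖ] A}
    (hf : f ∈ P.coboundaries (i + 1) n) :
    ∃ h : (P.ι i →₀ A) →ₗ[Aᵐᵒᵖ] A,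
      (∀ s, h (Finsupp.single s 1) ∈ component 𝒜 (n + P.deg i s)) ∧ h ∘ₗ P.d i = f := by
  obtain ⟨h, hh, rfl⟩ := hf
  exact ⟨h, hh, rfl⟩

/-- Dual form of minimality: a cochain with value 1 on a basis vector is never a coboundary. It
holds because `A₊` is also a left ideal. -/
theorem IsMinimal.apply_mem_of_mem_coboundaries (hP : P.IsMinimal) {i : ℕ} {n : ℤ}
    {f : (P.ι i →₀ A) →ₗ[Aᵐᵒᵖ] A} (hf : f ∈ P.coboundaries i n) (s : P.ι i) :
    f (Finsupp.single s 1) ∈ augmentationIdeal 𝒜 := by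
  cases i with
  | zero =>
    obtain rfl : f = 0 := hf
    exact zero_mem _
  | succ i =>
    obtain ⟨h, -, rfl⟩ := exists_of_mem_coboundaries hf
    rw [LinearMap.comp_apply, map_eq_sum_mul]
    exact sum_mem fun t _ => mul_mem_augmentationIdeal _ (hP i _ t)

theorem lapply_mem_component {i : ℕ} (s s' : P.ι i) :
    Finsupp.lapply (R := Aᵐᵒᵖ) s (Finsupp.single s' (1 : A)) ∈
      component 𝒜 (-P.deg i s + P.deg i s') := by
  classical
  rw [Finsupp.lapply_apply, Finsupp.single_apply]
  split_ifs with h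
  · subst h
    rw [neg_add_cancel]
    exact one_mem_component 𝒜
  · exact zero_mem _

/-- Where `Ext` vanishes, every generator of `Pᵢ` has smaller degree than some generator
of `Pᵢ₊₁`. -/
theorem IsMinimal.exists_lt_deg [Nontrivial A] (hP : P.IsMinimal) {i : ℕ} (s : P.ι i)
    (h : Subsingleton (P.gradedExt i (-P.deg i s))) : ∃ t, P.deg i s < P.deg (i + 1) t := by
  by_contra! hle
  have hcomp : Finsupp.lapply (R := Aᵐᵒᵖ) (M := A) s ∘ₗ P.d i = 0 := by
    refine hom_ext_single fun t => ?_
    exact eq_zero_of_mem_component_of_mem_augmentationIdeal (by linarith [hle t])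
      (P.d_homogeneous i t s) (hP _ _ _)
  have := hP.apply_mem_of_mem_coboundaries
    (mem_coboundaries h (lapply_mem_component s) hcomp) s
  rw [Finsupp.lapply_apply, Finsupp.single_eq_same] at this
  exact one_notMem_augmentationIdeal this

/-! ### Consequences of the Gorenstein condition at the end of the resolution -/

section Gorenstein

variable {d : ℕ} {l : ℤ}

/-- A generator of another degree would sit where `Ext` vanishes, and so lie below a generator of
`P_{d+1} = 0`. -/
theorem IsMinimal.deg_last [Nontrivial A] (hP : P.IsMinimal) (hempty : ∀ i, d < i → IsEmpty (P.ι i))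
    (hext : ∀ (i : ℕ) (n : ℤ), ¬ (i = d ∧ n = -l) → Subsingleton (P.gradedExt i n))
    (s : P.ι d) : P.deg d s = l := by
  by_contra hne
  obtain ⟨t, -⟩ := hP.exists_lt_deg s (hext _ _ fun h => hne (neg_injective h.2))
  exact (hempty (d + 1) (Nat.lt_succ_self d)).false t

theorem IsMinimal.exists_lt_deg_of_lt [Nontrivial A] (hP : P.IsMinimal)
    (hext : ∀ (i : ℕ) (n : ℤ), ¬ (i = d ∧ n = -l) → Subsingleton (P.gradedExt i n))
    {i : ℕ} (hi : i < d) (s : P.ι i) : ∃ t, P.deg i s < P.deg (i + 1) t :=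
  hP.exists_lt_deg s (hext _ _ fun h => hi.ne h.1)

/-- Upper bounds on degrees propagate from `P_d` down to `P₀`, since each generator lies below one
in the next term; finitely many generators per degree then means finite rank. -/
theorem IsMinimal.finite_of_gorenstein [Nontrivial A] (hP : P.IsMinimal)
    (hempty : ∀ i, d < i → IsEmpty (P.ι i))
    (hext : ∀ (i : ℕ) (n : ℤ), ¬ (i = d ∧ n = -l) → Subsingleton (P.gradedExt i n))
    (hfin : ∀ (i : ℕ) (n : ℤ), {s | P.deg i s ≤ n}.Finite) (i : ℕ) : Finite (P.ι i) := by
  have hbdd : ∀ i, (∃ n, ∀ s, P.deg i s ≤ n) → Finite (P.ι i) := by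
    rintro i ⟨n, hn⟩
    have := hfin i n
    rw [show {s | P.deg i s ≤ n} = Set.univ from Set.eq_univ_of_forall hn] at this
    exact Set.finite_univ_iff.1 this
  rcases lt_or_ge d i with hi | hi
  · have := hempty i hi
    infer_instance
  induction hi using Nat.decreasingInduction with
  | self => exact hbdd d ⟨l, fun s => (hP.deg_last hempty hext s).le⟩
  | of_succ i hi ih =>
    obtain ⟨n, hn⟩ := (Set.finite_range (P.deg (i + 1))).bddAbove
    refine hbdd i ⟨n, fun s => ?_⟩
    obtain ⟨t, ht⟩ := hP.exists_lt_deg_of_lt hext hi s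
    exact ht.le.trans (hn ⟨t, rfl⟩)

/-- The dual basis of `P_d` consists of cocycles whose classes are independent in `Ext`, because
coboundaries take values in `A₊`; so the rank of `P_d` is at most 1, and it is not 0. -/
theorem IsMinimal.nonempty_unique_last [Nontrivial A] (hP : P.IsMinimal)
    (hempty : ∀ i, d < i → IsEmpty (P.ι i))
    (hext : ∀ (i : ℕ) (n : ℤ), ¬ (i = d ∧ n = -l) → Subsingleton (P.gradedExt i n))
    (hrank : Module.finrank K (P.gradedExt d (-l)) = 1) : Nonempty (Unique (P.ι d)) := by
  have hne : Nonempty (P.ι d) := by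
    by_contra h
    rw [not_nonempty_iff] at h
    have : Subsingleton (P.gradedExt d (-l)) := by
      refine ⟨?_⟩
      rintro ⟨_, f, -, rfl⟩ ⟨_, g, -, rfl⟩
      exact Subtype.ext (congrArg (P.coboundaries d (-l)).mkQ (Subsingleton.elim f g))
    rw [Module.finrank_zero_of_subsingleton] at hrank
    exact zero_ne_one hrank
  obtain ⟨u⟩ := hne
  refine ⟨⟨⟨u⟩, fun s => ?_⟩⟩
  by_contra hsu
  have hmem : ∀ s : P.ι d, (P.coboundaries d (-l)).mkQ (Finsupp.lapply s) ∈
      P.gradedExt d (-l) := by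
    intro s
    have := hempty (d + 1) (Nat.lt_succ_self d)
    refine ⟨_, ⟨fun s' => ?_, ?_⟩, rfl⟩
    · have := lapply_mem_component (P := P) s s'
      rwa [hP.deg_last hempty hext s] at this
    · exact hom_ext_single fun t => (this.false t).elim
  have hu : (⟨_, hmem u⟩ : P.gradedExt d (-l)) ≠ 0 := by
    intro h
    have h0 : (P.coboundaries d (-l)).mkQ (Finsupp.lapply u) = 0 := congrArg Subtype.val h
    rw [Submodule.mkQ_apply, Submodule.Quotient.mk_eq_zero] at h0
    have := hP.apply_mem_of_mem_coboundaries h0 u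
    rw [Finsupp.lapply_apply, Finsupp.single_eq_same] at this
    exact one_notMem_augmentationIdeal this
  obtain ⟨c, hc⟩ := (finrank_eq_one_iff_of_nonzero' _ hu).1 hrank ⟨_, hmem s⟩
  have h0 : c • (P.coboundaries d (-l)).mkQ (Finsupp.lapply u) =
      (P.coboundaries d (-l)).mkQ (Finsupp.lapply s) := congrArg Subtype.val hc
  rw [← map_smul, ← sub_eq_zero, ← map_sub, Submodule.mkQ_apply,
    Submodule.Quotient.mk_eq_zero] at h0
  have := hP.apply_mem_of_mem_coboundaries h0 s
  rw [LinearMap.sub_apply, LinearMap.smul_apply, Finsupp.lapply_apply, Finsupp.lapply_apply,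
    Finsupp.single_eq_same, Finsupp.single_eq_of_ne (show u ≠ s from fun h => hsu h.symm), smul_zero, zero_sub] at this
  exact one_notMem_augmentationIdeal (by simpa using neg_mem this)

/-- A homogeneous element of positive degree times the last dual basis vector is a coboundary. -/
theorem exists_comp_eq_smul_lapply {e : ℕ} [Unique (P.ι (e + 1))]
    (hlast : ∀ u : P.ι (e + 1), P.deg (e + 1) u = l) (hempty : IsEmpty (P.ι (e + 2)))
    (hext : ∀ (i : ℕ) (n : ℤ), ¬ (i = e + 1 ∧ n = -l) → Subsingleton (P.gradedExt i n))
    {m : ℤ} (hm : m ≠ 0) {b : A} (hb : b ∈ component 𝒜 m) :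
    ∃ h : (P.ι e →₀ A) →ₗ[Aᵐᵒᵖ] A,
      (∀ s, h (Finsupp.single s 1) ∈ component 𝒜 (m - l + P.deg e s)) ∧
        h (P.d e (Finsupp.single default 1)) = b := by
  have hcob : b • Finsupp.lapply (R := Aᵐᵒᵖ) (M := A) (default : P.ι (e + 1)) ∈
      P.coboundaries (e + 1) (m - l) := by
    refine mem_coboundaries (hext _ _ fun h => hm (by linarith [h.2])) (fun s => ?_) ?_
    · rw [hlast, sub_add_cancel, LinearMap.smul_apply, Finsupp.lapply_apply, Unique.eq_default s,
        Finsupp.single_eq_same, smul_eq_mul, mul_one]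
      exact hb
    · exact hom_ext_single fun t => (hempty.false t).elim
  obtain ⟨h, hh, hd⟩ := exists_of_mem_coboundaries hcob
  refine ⟨h, hh, ?_⟩
  have := LinearMap.congr_fun hd (Finsupp.single default 1)
  rw [LinearMap.comp_apply] at this
  rw [this, LinearMap.smul_apply, Finsupp.lapply_apply, Finsupp.single_eq_same, smul_eq_mul,
    mul_one]

/-- The argument of `deg_one` in the dual complex: if the degree gap at `s` exceeded 1, the
coefficient of the last differential at `s` would lie in `A₁ Aₙ` with `n > 0`, and so also be the
value of a cochain `h` that vanishes on `s`. -/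
theorem IsMinimal.deg_penultimate (h𝒜 : IsStandardGraded 𝒜) (hP : P.IsMinimal) {e : ℕ}
    [Unique (P.ι (e + 1))] (hempty : ∀ i, e + 1 < i → IsEmpty (P.ι i))
    (hext : ∀ (i : ℕ) (n : ℤ), ¬ (i = e + 1 ∧ n = -l) → Subsingleton (P.gradedExt i n))
    (s : P.ι e) : P.deg e s = l - 1 := by
  have := h𝒜.nontrivial
  have hlast : ∀ u, P.deg (e + 1) u = l := hP.deg_last hempty hext
  obtain ⟨t, ht⟩ := hP.exists_lt_deg_of_lt hext (Nat.lt_succ_self e) s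
  rw [hlast] at ht
  by_contra hne
  obtain ⟨n, hn⟩ : ∃ n : ℕ, l - P.deg e s = ((n + 1 : ℕ) : ℤ) :=
    ⟨(l - P.deg e s).toNat - 1, by omega⟩
  have hn0 : n ≠ 0 := by rintro rfl; push_cast at hn; omega
  have hx : P.d e (Finsupp.single default 1) s ∈ 𝒜 (n + 1) := by
    have := P.d_homogeneous e default s
    rwa [hlast, hn, component_natCast] at this
  have key : ∃ h : (P.ι e →₀ A) →ₗ[Aᵐᵒᵖ] A,
      (∀ s', h (Finsupp.single s' 1) ∈ component 𝒜 (-P.deg e s + P.deg e s')) ∧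
        h (P.d e (Finsupp.single default 1)) = P.d e (Finsupp.single default 1) s ∧
          h (Finsupp.single s 1) = 0 := by
    refine Submodule.mul_induction_on (C := fun a => ∃ h : (P.ι e →₀ A) →ₗ[Aᵐᵒᵖ] A,
      (∀ s', h (Finsupp.single s' 1) ∈ component 𝒜 (-P.deg e s + P.deg e s')) ∧
        h (P.d e (Finsupp.single default 1)) = a ∧ h (Finsupp.single s 1) = 0)
        (h𝒜.mem_mul hx) ?_ ?_
    · intro p hp q hq
      rw [← component_natCast 𝒜] at hp hq
      obtain ⟨h, hh, hd⟩ := exists_comp_eq_smul_lapply hlast (hempty (e + 2) (by omega)) hext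
        (by exact_mod_cast hn0) hq
      refine ⟨p • h, fun s' => ?_, ?_, ?_⟩
      · have := mul_mem_component 𝒜 hp (hh s')
        rwa [show ((1 : ℕ) : ℤ) + (n - l + P.deg e s') = -P.deg e s + P.deg e s' by
          push_cast at hn ⊢; omega] at this
      · rw [LinearMap.smul_apply, hd, smul_eq_mul]
      · rw [LinearMap.smul_apply,
          eq_zero_of_mem_component (by push_cast at hn; omega) (hh s), smul_zero]
    · rintro a b ⟨f, hf, hf', hf''⟩ ⟨g, hg, hg', hg''⟩
      exact ⟨f + g, fun s' => add_mem (hf s') (hg s'), by rw [LinearMap.add_apply, hf', hg'],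
        by rw [LinearMap.add_apply, hf'', hg'', add_zero]⟩
  obtain ⟨h, hh, hd, hs⟩ := key
  -- The two cochains agree on the image of the last generator, so their difference is a cocycle,
  -- hence a coboundary; yet it takes the value 1 at `s`.
  have hcob : Finsupp.lapply s - h ∈ P.coboundaries e (-P.deg e s) := by
    refine mem_coboundaries (hext _ _ fun h => by omega)
      (fun s' => sub_mem (lapply_mem_component s s') (hh s')) ?_
    refine hom_ext_single fun u => ?_
    rw [Unique.eq_default u, LinearMap.comp_apply, LinearMap.sub_apply, hd, Finsupp.lapply_apply,
      sub_self, LinearMap.zero_apply]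
  have := hP.apply_mem_of_mem_coboundaries hcob s
  rw [LinearMap.sub_apply, hs, Finsupp.lapply_apply, Finsupp.single_eq_same, sub_zero] at this
  exact one_notMem_augmentationIdeal this

end Gorenstein

end GradedFreeResolution

/-! ### Linear relations in quadratic algebras -/

section Quadratic

variable {K A : Type*} [Field K] [Ring A] [Algebra K A] {𝒜 : ℕ → Submodule K A}
  {T : Type*} [Fintype T]

/-- A representation of the tensor algebra of `A₁` that kills the quadratic relations kills the
whole kernel of `T(A₁) → A`. -/
theorem IsQuadratic.lift_eq_zero (hq : IsQuadratic 𝒜) {B : Type*} [Ring B] [Algebra K B]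
    (Φ : TensorAlgebra K (𝒜 1) →ₐ[K] B)
    (hΦ : ∀ r ∈ LinearMap.range (TensorAlgebra.ι K (M := 𝒜 1)) ^ 2,
      TensorAlgebra.lift K (𝒜 1).subtype r = 0 → Φ r = 0)
    {z : TensorAlgebra K (𝒜 1)} (hz : TensorAlgebra.lift K (𝒜 1).subtype z = 0) : Φ z = 0 := by
  have h1 : z ∈ TwoSidedIdeal.ker (TensorAlgebra.lift K (𝒜 1).subtype) :=
    (TwoSidedIdeal.mem_ker _).2 hz
  rw [hq.2] at h1
  have h2 : TwoSidedIdeal.span {r : TensorAlgebra K (𝒜 1) |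
      r ∈ LinearMap.range (TensorAlgebra.ι K (M := 𝒜 1)) ^ 2 ∧
        TensorAlgebra.lift K (𝒜 1).subtype r = 0} ≤ TwoSidedIdeal.ker Φ := by
    rw [TwoSidedIdeal.span_le]
    exact fun r hr => (TwoSidedIdeal.mem_ker _).2 (hΦ r hr.1 hr.2)
  exact (TwoSidedIdeal.mem_ker _).1 (h2 h1)

theorem IsQuadratic.lift_surjective (hq : IsQuadratic 𝒜) :
    Function.Surjective (TensorAlgebra.lift K (𝒜 1).subtype) := by
  rw [← AlgHom.range_eq_top, eq_top_iff, ← hq.1, Algebra.adjoin_le_iff]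
  exact fun a ha => ⟨TensorAlgebra.ι K ⟨a, ha⟩, by simp⟩

/-- In a quadratic algebra, the left linear relations among a basis of `A₁` are generated by those
with coefficients in `A₁`. -/
theorem IsQuadratic.mem_span_left (hq : IsQuadratic 𝒜) (b : Module.Basis T K (𝒜 1)) {a : T → A}
    (ha : ∑ t, a t * (b t : A) = 0) :
    a ∈ Submodule.span A {r : T → A | (∀ t, r t ∈ 𝒜 1) ∧ ∑ t, r t * (b t : A) = 0} := by
  classical
  set M := Submodule.span A {r : T → A | (∀ t, r t ∈ 𝒜 1) ∧ ∑ t, r t * (b t : A) = 0}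
  let e : 𝒜 1 →ₗ[K] (T → A) := LinearMap.pi fun t => Algebra.linearMap K A ∘ₗ b.coord t
  let q : (T → A) →ₗ[A] ((T → A) ⧸ M) := M.mkQ
  have hqK : ∀ (c : K) (x : T → A), q (c • x) = c • q x := fun c x => rfl
  -- An action of `T(A₁)` on an extension of the trivial module `K` by `Aᵀ / M`, where `v` sends
  -- `(1, 0)` to the class of its coordinate vector. Dividing by `M` is what makes the quadratic
  -- relations act as zero.
  let ρ : 𝒜 1 →ₗ[K] Module.End K (K × ((T → A) ⧸ M)) :=
    LinearMap.mk₂ K (fun v w => (0, w.1 • q (e v) + (v : A) • w.2))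
      (fun v v' w => by
        ext1
        · simp
        · simp only [map_add, smul_add, Submodule.coe_add, add_smul, Prod.mk_add_mk]
          abel)
      (fun c v w => by
        ext1
        · simp
        · simp only [map_smul, hqK, Submodule.coe_smul, smul_assoc, Prod.smul_mk, smul_add]
          rw [smul_comm])
      (fun v w w' => by
        ext1
        · simp
        · simp only [Prod.fst_add, Prod.snd_add, smul_add, add_smul, Prod.mk_add_mk]
          abel)
      (fun c v w => by
        ext1
        · simp
        · simp only [Prod.smul_fst, Prod.smul_snd, smul_assoc, Prod.smul_mk, smul_add]
          rw [smul_comm (v : A) c])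
  let Φ := TensorAlgebra.lift K ρ
  let π := TensorAlgebra.lift K (𝒜 1).subtype
  have hΦι : ∀ v w, Φ (TensorAlgebra.ι K v) w = (0, w.1 • q (e v) + (v : A) • w.2) := by
    intro v w
    simp only [Φ, TensorAlgebra.lift_ι_apply]
    rfl
  have hΦ0 : ∀ z x, Φ z (0, x) = (0, π z • x) := by
    intro z
    induction z using TensorAlgebra.induction with
    | algebraMap c => intro x; simp [Module.algebraMap_end_apply]
    | ι v => intro x; simp [hΦι, π]
    | mul y z hy hz => intro x; simp [hy, hz, mul_smul]
    | add y z hy hz => intro x; simp [hy, hz, add_smul]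
  have hquad : ∀ r ∈ LinearMap.range (TensorAlgebra.ι K (M := 𝒜 1)) ^ 2,
      ∃ r' : T → A, (∀ t, r' t ∈ 𝒜 1) ∧ ∑ t, r' t * (b t : A) = π r ∧
        ∀ w, Φ r w = (0, w.1 • q r' + π r • w.2) := by
    intro r hr
    rw [pow_two] at hr
    induction hr using Submodule.mul_induction_on' with
    | mem_mul_mem m hm n hn =>
      obtain ⟨v, rfl⟩ := hm
      obtain ⟨w, rfl⟩ := hn
      refine ⟨(v : A) • e w, fun t => ?_, ?_, fun p => ?_⟩
      · have : ((v : A) • e w) t = b.repr w t • (v : A) := by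
          simp [e, Algebra.commutes, Algebra.smul_def]
        rw [this]
        exact (𝒜 1).smul_mem _ v.2
      · have hw : (w : A) = ∑ t, b.repr w t • (b t : A) :=
          (congrArg Subtype.val (b.sum_repr w).symm).trans (by simp only [Submodule.coe_sum,
            Submodule.coe_smul])
        simp only [π, map_mul, TensorAlgebra.lift_ι_apply, Submodule.subtype_apply]
        rw [hw, Finset.mul_sum]
        refine Finset.sum_congr rfl fun t _ => ?_
        simp [e, Algebra.smul_def, mul_assoc]
      · rw [map_mul, Module.End.mul_apply, hΦι, hΦι, map_smul]
        simp only [π, map_mul, TensorAlgebra.lift_ι_apply, Submodule.subtype_apply, zero_smul,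
          zero_add, smul_add, mul_smul]
        rw [smul_comm (v : A) p.1]
    | add x _ y _ hx hy =>
      obtain ⟨r, hr, hr', hr''⟩ := hx
      obtain ⟨r₂, hr₂, hr₂', hr₂''⟩ := hy
      refine ⟨r + r₂, fun t => add_mem (hr t) (hr₂ t), ?_, fun w => ?_⟩
      · simp only [Pi.add_apply, add_mul, Finset.sum_add_distrib, hr', hr₂', map_add]
      · rw [map_add, LinearMap.add_apply, hr'', hr₂'', map_add, map_add, Prod.mk_add_mk, add_zero,
          smul_add, add_smul, add_add_add_comm]
  choose y hy using fun t => hq.lift_surjective (a t)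
  have hz : π (∑ t, y t * TensorAlgebra.ι K (b t)) = 0 := by
    rw [← ha, map_sum]
    refine Finset.sum_congr rfl fun t _ => ?_
    rw [map_mul, hy]
    simp [π]
  have h0 : Φ (∑ t, y t * TensorAlgebra.ι K (b t)) = 0 := by
    refine hq.lift_eq_zero Φ (fun r hr hr0 => ?_) hz
    obtain ⟨r', hr1, hr2, hr3⟩ := hquad r hr
    have hr' : q r' = 0 :=
      (Submodule.Quotient.mk_eq_zero M).2 (Submodule.subset_span ⟨hr1, hr2.trans hr0⟩)
    refine LinearMap.ext fun w => ?_
    rw [hr3, hr', show π r = 0 from hr0]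
    simp
  -- Acting on `(1, 0)` recovers the class of `a` modulo `M`, while the lifted relation acts as
  -- zero.
  have hterm : ∀ t, Φ (y t * TensorAlgebra.ι K (b t)) (1, 0) =
      LinearMap.inr K K _ (q (a t • e (b t))) := by
    intro t
    rw [map_mul, Module.End.mul_apply, hΦι, one_smul, smul_zero, add_zero, hΦ0,
      show π (y t) = a t from hy t, map_smul]
    rfl
  have h1 : LinearMap.inr K K _ (q (∑ t, a t • e (b t))) = 0 := by
    rw [map_sum, map_sum, ← Finset.sum_congr rfl fun t _ => hterm t, ← LinearMap.sum_apply,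
      ← map_sum, h0, LinearMap.zero_apply]
  have h2 : ∑ t, a t • e (b t) = a := by
    ext t
    simp [e, Finsupp.single_apply, Finset.sum_apply]
  rw [← h2]
  exact (Submodule.Quotient.mk_eq_zero M).1 (LinearMap.inr_injective (h1.trans (map_zero _).symm))

/-- In a quadratic algebra, the right linear relations among a basis of `A₁` are generated by those
with coefficients in `A₁`. -/
theorem IsQuadratic.mem_span_right (hq : IsQuadratic 𝒜) (b : Module.Basis T K (𝒜 1)) {a : T → A}
    (ha : ∑ t, (b t : A) * a t = 0) :
    a ∈ Submodule.span Aᵐᵒᵖ {r : T → A | (∀ t, r t ∈ 𝒜 1) ∧ ∑ t, (b t : A) * r t = 0} := by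
  classical
  set M := Submodule.span Aᵐᵒᵖ {r : T → A | (∀ t, r t ∈ 𝒜 1) ∧ ∑ t, (b t : A) * r t = 0}
  let e : 𝒜 1 →ₗ[K] (T → A) := LinearMap.pi fun t => Algebra.linearMap K A ∘ₗ b.coord t
  let q : (T → A) →ₗ[Aᵐᵒᵖ] ((T → A) ⧸ M) := M.mkQ
  have hqK : ∀ (c : K) (x : T → A), q (c • x) = c • q x := fun c x => rfl
  let ρ : 𝒜 1 →ₗ[K] Module.End K (K × ((T → A) ⧸ M)) :=
    LinearMap.mk₂ K (fun v w => (0, w.1 • q (e v) + op (v : A) • w.2))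
      (fun v v' w => by
        ext1
        · simp
        · simp only [map_add, smul_add, Submodule.coe_add, MulOpposite.op_add, add_smul, Prod.mk_add_mk]
          abel)
      (fun c v w => by
        ext1
        · simp
        · simp only [map_smul, hqK, Submodule.coe_smul, MulOpposite.op_smul, smul_assoc, Prod.smul_mk, smul_add]
          rw [smul_comm])
      (fun v w w' => by
        ext1
        · simp
        · simp only [Prod.fst_add, Prod.snd_add, smul_add, add_smul, Prod.mk_add_mk]
          abel)
      (fun c v w => by
        ext1
        · simp
        · simp only [Prod.smul_fst, Prod.smul_snd, smul_assoc, Prod.smul_mk, smul_add]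
          rw [smul_comm (op (v : A)) c])
  -- Right multiplication reverses products, so the representation takes values in the opposite
  -- endomorphism algebra.
  let Φ := TensorAlgebra.lift K ((opLinearEquiv K).toLinearMap ∘ₗ ρ)
  let π := TensorAlgebra.lift K (𝒜 1).subtype
  have hΦι : ∀ v w, unop (Φ (TensorAlgebra.ι K v)) w = (0, w.1 • q (e v) + op (v : A) • w.2) := by
    intro v w
    simp only [Φ, TensorAlgebra.lift_ι_apply]
    rfl
  have hΦ0 : ∀ z x, unop (Φ z) (0, x) = (0, op (π z) • x) := by
    intro z
    induction z using TensorAlgebra.induction with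
    | algebraMap c =>
      intro x
      rw [AlgHom.commutes, AlgHom.commutes, Algebra.algebraMap_eq_smul_one (A := A) c,
        MulOpposite.op_smul, op_one, smul_assoc, one_smul]
      simp [Module.algebraMap_end_apply]
    | ι v => intro x; simp [hΦι, π]
    | mul y z hy hz => intro x; simp [hy, hz, mul_smul]
    | add y z hy hz => intro x; simp [hy, hz, add_smul]
  have hquad : ∀ r ∈ LinearMap.range (TensorAlgebra.ι K (M := 𝒜 1)) ^ 2,
      ∃ r' : T → A, (∀ t, r' t ∈ 𝒜 1) ∧ ∑ t, (b t : A) * r' t = π r ∧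
        ∀ w, unop (Φ r) w = (0, w.1 • q r' + op (π r) • w.2) := by
    intro r hr
    rw [pow_two] at hr
    induction hr using Submodule.mul_induction_on' with
    | mem_mul_mem m hm n hn =>
      obtain ⟨v, rfl⟩ := hm
      obtain ⟨w, rfl⟩ := hn
      refine ⟨op (w : A) • e v, fun t => ?_, ?_, fun p => ?_⟩
      · have : (op (w : A) • e v) t = b.repr v t • (w : A) := by
          simp [e, Algebra.smul_def]
        rw [this]
        exact (𝒜 1).smul_mem _ w.2
      · have hv : (v : A) = ∑ t, b.repr v t • (b t : A) :=
          (congrArg Subtype.val (b.sum_repr v).symm).trans (by simp only [Submodule.coe_sum,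
            Submodule.coe_smul])
        simp only [π, map_mul, TensorAlgebra.lift_ι_apply, Submodule.subtype_apply]
        rw [hv, Finset.sum_mul]
        refine Finset.sum_congr rfl fun t _ => ?_
        simp [e, Algebra.smul_def, mul_assoc, Algebra.commutes]
      · rw [map_mul, MulOpposite.unop_mul, Module.End.mul_apply, hΦι, hΦι, map_smul]
        simp only [π, map_mul, TensorAlgebra.lift_ι_apply, Submodule.subtype_apply, zero_smul,
          zero_add, smul_add]
        rw [smul_comm (op (w : A)) p.1, MulOpposite.op_mul, mul_smul]
    | add x _ y _ hx hy =>
      obtain ⟨r, hr, hr', hr''⟩ := hx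
      obtain ⟨r₂, hr₂, hr₂', hr₂''⟩ := hy
      refine ⟨r + r₂, fun t => add_mem (hr t) (hr₂ t), ?_, fun w => ?_⟩
      · simp only [Pi.add_apply, mul_add, Finset.sum_add_distrib, hr', hr₂', map_add]
      · rw [map_add, MulOpposite.unop_add, LinearMap.add_apply, hr'', hr₂'', map_add, map_add, MulOpposite.op_add, Prod.mk_add_mk, add_zero,
          smul_add, add_smul, add_add_add_comm]
  choose y hy using fun t => hq.lift_surjective (a t)
  have hz : π (∑ t, TensorAlgebra.ι K (b t) * y t) = 0 := by
    rw [← ha, map_sum]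
    refine Finset.sum_congr rfl fun t _ => ?_
    rw [map_mul, hy]
    simp [π]
  have h0 : Φ (∑ t, TensorAlgebra.ι K (b t) * y t) = 0 := by
    refine hq.lift_eq_zero Φ (fun r hr hr0 => ?_) hz
    obtain ⟨r', hr1, hr2, hr3⟩ := hquad r hr
    have hr' : q r' = 0 :=
      (Submodule.Quotient.mk_eq_zero M).2 (Submodule.subset_span ⟨hr1, hr2.trans hr0⟩)
    refine unop_injective (LinearMap.ext fun w => ?_)
    rw [hr3, hr', show π r = 0 from hr0]
    simp
  have hterm : ∀ t, unop (Φ (TensorAlgebra.ι K (b t) * y t)) (1, 0) =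
      LinearMap.inr K K _ (q (op (a t) • e (b t))) := by
    intro t
    rw [map_mul, MulOpposite.unop_mul, Module.End.mul_apply, hΦι, one_smul, smul_zero, add_zero, hΦ0,
      show π (y t) = a t from hy t, map_smul]
    rfl
  have h1 : LinearMap.inr K K _ (q (∑ t, op (a t) • e (b t))) = 0 := by
    rw [map_sum, map_sum, ← Finset.sum_congr rfl fun t _ => hterm t, ← LinearMap.sum_apply,
      ← Finset.unop_sum, ← map_sum, h0, MulOpposite.unop_zero, LinearMap.zero_apply]
  have h2 : ∑ t, op (a t) • e (b t) = a := by
    ext t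
    simp [e, Finsupp.single_apply, Finset.sum_apply]
  rw [← h2]
  exact (Submodule.Quotient.mk_eq_zero M).1 (LinearMap.inr_injective (h1.trans (map_zero _).symm))

end Quadratic

section

variable {K A : Type*} [Field K] [Ring A] [Algebra K A] {𝒜 : ℕ → Submodule K A}

theorem exists_basis_eq {T : Type*} {x : T → A} (hx : ∀ t, x t ∈ 𝒜 1)
    (hli : LinearIndependent K x) (hspan : ∀ a ∈ 𝒜 1, a ∈ Submodule.span K (Set.range x)) :
    ∃ b : Module.Basis T K (𝒜 1), ∀ t, (b t : A) = x t := by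
  let v : T → 𝒜 1 := fun t => ⟨x t, hx t⟩
  have hv : LinearIndependent K v := LinearIndependent.of_comp (𝒜 1).subtype hli
  refine ⟨Module.Basis.mk hv ?_, fun t => by rw [Module.Basis.mk_apply]⟩
  rintro ⟨a, ha⟩ -
  have h := hspan a ha
  have hr : Set.range x = (𝒜 1).subtype '' Set.range v := by
    rw [← Set.range_comp]
    rfl
  rw [hr, ← Submodule.map_span] at h
  obtain ⟨w, hw, hwa⟩ := h
  obtain rfl : w = ⟨a, ha⟩ := Subtype.ext hwa
  exact hw

end

/-! ### Third terms from both ends over a quadratic algebra -/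

namespace GradedFreeResolution

variable {K A : Type*} [Field K] [Ring A] [Algebra K A] {𝒜 : ℕ → Submodule K A} [GradedAlgebra 𝒜]
  {P : GradedFreeResolution 𝒜}

/-- Over a quadratic algebra, `P₂` is generated in degree two. -/
theorem IsMinimal.deg_two (h𝒜 : IsStandardGraded 𝒜) (hq : IsQuadratic 𝒜) (hP : P.IsMinimal)
    [Unique (P.ι 0)] [Finite (P.ι 1)] (h0 : ∀ s, P.deg 0 s = 0)
    (hsurj : ∀ x : P.ι 0 →₀ A, (∀ s, x s ∈ augmentationIdeal 𝒜) → ∃ y, P.d 0 y = x)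
    (t : P.ι 2) : P.deg 2 t = 2 := by
  have := h𝒜.nontrivial
  have := Fintype.ofFinite (P.ι 1)
  have h1 : ∀ s, P.deg 1 s = 1 := hP.deg_one h𝒜 h0 hsurj
  have hlt : 1 < P.deg 2 t := by
    obtain ⟨s, hs⟩ := hP.exists_deg_lt t
    rwa [h1] at hs
  by_contra hne
  let x : P.ι 1 → A := fun s => P.d 0 (Finsupp.single s 1) default
  have hsum : ∀ y, P.d 0 y default = ∑ s, x s * y s := fun y => by
    rw [map_apply_eq_sum_mul, Finsupp.sum_fintype _ _ (by simp)]
  have hx : ∀ s, x s ∈ component 𝒜 1 := fun s => by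
    have := P.d_homogeneous 0 s default
    rwa [h0, h1, sub_zero] at this
  have hx' : ∀ s, x s ∈ 𝒜 1 := fun s => by
    rw [← component_natCast 𝒜]
    exact hx s
  have hli : LinearIndependent K x := by
    have h := linearIndependent_of_ker (K := K) (Finsupp.lapply default ∘ₗ P.d 0)
      (fun y hy => hP.mem_of_d_eq_zero (by
        rw [eq_single (P.d 0 y), show P.d 0 y default = 0 from hy, Finsupp.single_zero]))
    exact h
  obtain ⟨b, hb⟩ := exists_basis_eq hx' hli fun a ha => by
    rw [← component_natCast 𝒜] at ha
    obtain ⟨y, hy⟩ := hsurj (Finsupp.single default a) fun s => by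
      rw [Unique.eq_default s, Finsupp.single_eq_same]
      exact mem_augmentationIdeal_of_mem_component (by norm_num) ha
    have hya : a = ∑ s, x s * y s := by rw [← hsum, hy, Finsupp.single_eq_same]
    rw [← intProj_of_mem ha, hya, map_sum]
    refine sum_mem fun s _ => ?_
    obtain ⟨c, hc⟩ := h𝒜.exists_smul_one (intProj_mem 𝒜 0 (y s))
    have := intProj_mul_left (hx s) 0 (y s)
    rw [add_zero] at this
    rw [Nat.cast_one, this, hc, mul_smul_comm, mul_one]
    exact Submodule.smul_mem _ _ (Submodule.subset_span ⟨s, rfl⟩)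
  have hrel : ∑ s, (b s : A) * P.d 1 (Finsupp.single t 1) s = 0 := by
    simp only [hb]
    rw [← hsum, d_comp_d, Finsupp.zero_apply]
  -- The image of `t` is a relation among the basis `x` of `A₁`, hence a combination of relations
  -- with coefficients in `A₁`. Those lift to degree 2 in `P₂`, and `t` has degree above 2, so its
  -- coordinate is zero.
  have key : ∃ y, (∀ s, P.d 1 y s = P.d 1 (Finsupp.single t 1) s) ∧ y t = 0 := by
    refine Submodule.span_induction
      (p := fun (a : P.ι 1 → A) _ => ∃ y, (∀ s, P.d 1 y s = a s) ∧ y t = 0) ?_ ?_ ?_ ?_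
      (hq.mem_span_right b hrel)
    · rintro r ⟨hr, hr0⟩
      have hker : P.d 0 (Finsupp.equivFunOnFinite.symm r) = 0 := by
        rw [eq_single (P.d 0 _), hsum]
        simp only [hb] at hr0
        simp [hr0]
      obtain ⟨y, hy⟩ := (P.exact 0 _).1 hker
      obtain ⟨z, hz, hz'⟩ := exists_homogeneous_preimage (hP.deg_nonneg h0) (n := 2) (y := y)
        fun s => by
          have := hr s
          rw [← component_natCast 𝒜] at this
          rw [hy, h1]
          exact this
      refine ⟨z, fun s => by rw [hz, hy]; rfl, ?_⟩
      exact eq_zero_of_mem_component (by push_cast; omega) (hz' t)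
    · exact ⟨0, by simp, by simp⟩
    · rintro a a' _ _ ⟨y, hy, hyt⟩ ⟨z, hz, hzt⟩
      exact ⟨y + z, fun s => by rw [map_add, Finsupp.add_apply, hy, hz, Pi.add_apply],
        by simp [hyt, hzt]⟩
    · rintro c a _ ⟨y, hy, hyt⟩
      exact ⟨c • y, fun s => by rw [map_smul, Finsupp.smul_apply, hy, Pi.smul_apply],
        by simp [hyt]⟩
  obtain ⟨y, hy, hyt⟩ := key
  have hker : P.d 1 (Finsupp.single t 1 - y) = 0 := by
    rw [map_sub, sub_eq_zero]
    ext s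
    exact (hy s).symm
  have := hP.mem_of_d_eq_zero hker t
  rw [Finsupp.sub_apply, hyt, Finsupp.single_eq_same, sub_zero] at this
  exact one_notMem_augmentationIdeal this

/-- Over a quadratic algebra satisfying the Gorenstein condition, the third term from the end of a
minimal resolution is generated in degree `l - 2`. -/
theorem IsMinimal.deg_antepenultimate (h𝒜 : IsStandardGraded 𝒜) (hq : IsQuadratic 𝒜)
    (hP : P.IsMinimal) {e : ℕ} {l : ℤ} [Unique (P.ι (e + 2))] [Finite (P.ι (e + 1))]
    (hempty : ∀ i, e + 2 < i → IsEmpty (P.ι i))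
    (hext : ∀ (i : ℕ) (n : ℤ), ¬ (i = e + 2 ∧ n = -l) → Subsingleton (P.gradedExt i n))
    (s : P.ι e) : P.deg e s = l - 2 := by
  have := h𝒜.nontrivial
  have := Fintype.ofFinite (P.ι (e + 1))
  have hlast : ∀ u, P.deg (e + 2) u = l := hP.deg_last hempty hext
  have hpen : ∀ t, P.deg (e + 1) t = l - 1 := hP.deg_penultimate h𝒜 hempty hext
  have hlt : P.deg e s < l - 1 := by
    obtain ⟨t, ht⟩ := hP.exists_lt_deg_of_lt hext (show e < e + 2 by omega) s
    rwa [hpen] at ht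
  by_contra hne
  let x : P.ι (e + 1) →₀ A := P.d (e + 1) (Finsupp.single default 1)
  have hsum : ∀ f : (P.ι (e + 1) →₀ A) →ₗ[Aᵐᵒᵖ] A,
      f x = ∑ t, f (Finsupp.single t 1) * x t := fun f => by
    rw [map_eq_sum_mul, Finsupp.sum_fintype _ _ (by simp)]
  have hcomp : ∀ f : (P.ι (e + 1) →₀ A) →ₗ[Aᵐᵒᵖ] A, f x = 0 → f ∘ₗ P.d (e + 1) = 0 :=
    fun f hf => hom_ext_single fun u => by rw [Unique.eq_default u]; exact hf
  have hx : ∀ t, x t ∈ component 𝒜 1 := fun t => by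
    have := P.d_homogeneous (e + 1) default t
    rwa [hlast, hpen, sub_sub_cancel] at this
  have hx' : ∀ t, x t ∈ 𝒜 1 := fun t => by
    rw [← component_natCast 𝒜]
    exact hx t
  -- A scalar relation defines a cocycle with scalar values in degree `1 - l`, where `Ext` vanishes;
  -- being a coboundary, it has values in `A₊`, so the scalars are zero.
  have hli : LinearIndependent K x := by
    rw [Fintype.linearIndependent_iff]
    intro c hc t
    let f : (P.ι (e + 1) →₀ A) →ₗ[Aᵐᵒᵖ] A := freeLift fun t => c t • (1 : A)
    have hf : ∀ t, f (Finsupp.single t 1) = c t • 1 := fun t => by simp [f]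
    have hcob : f ∈ P.coboundaries (e + 1) (1 - l) := by
      refine mem_coboundaries (hext _ _ fun h => by omega) (fun t => ?_) (hcomp f ?_)
      · rw [hf, hpen, sub_add_sub_cancel', sub_self]
        exact (component 𝒜 0).smul_mem _ (one_mem_component 𝒜)
      · rw [hsum, ← hc]
        exact Finset.sum_congr rfl fun t _ => by rw [hf, smul_mul_assoc, one_mul]
    have := hP.apply_mem_of_mem_coboundaries hcob t
    rw [hf] at this
    exact eq_zero_of_smul_one_mem_augmentationIdeal this
  obtain ⟨b, hb⟩ := exists_basis_eq hx' hli fun a ha => by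
    rw [← component_natCast 𝒜] at ha
    obtain ⟨h, hh, rfl⟩ := exists_comp_eq_smul_lapply hlast (hempty (e + 3) (by omega)) hext
      (by norm_num) ha
    rw [show h (P.d (e + 1) (Finsupp.single default 1)) = h x from rfl, hsum]
    refine sum_mem fun t _ => ?_
    have ht := hh t
    rw [hpen, Nat.cast_one, sub_add_sub_cancel', sub_self] at ht
    obtain ⟨c, hc⟩ := h𝒜.exists_smul_one ht
    rw [hc, smul_mul_assoc, one_mul]
    exact Submodule.smul_mem _ _ (Submodule.subset_span ⟨t, rfl⟩)
  have hrel : ∑ t, P.d e (Finsupp.single t 1) s * (b t : A) = 0 := by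
    simp only [hb]
    have h := hsum (Finsupp.lapply s ∘ₗ P.d e)
    rw [LinearMap.comp_apply, d_comp_d, map_zero] at h
    exact h.symm
  have key : ∃ h : (P.ι e →₀ A) →ₗ[Aᵐᵒᵖ] A,
      (∀ s', h (Finsupp.single s' 1) ∈ component 𝒜 (-P.deg e s + P.deg e s')) ∧
        (∀ t, h (P.d e (Finsupp.single t 1)) =
          intProj 𝒜 (l - 1 - P.deg e s) (P.d e (Finsupp.single t 1) s)) ∧
          h (Finsupp.single s 1) = 0 := by
    -- The span has arbitrary ring coefficients, whereas `h` must be homogeneous. Induction over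
    -- sums of terms `c • r` allows each `c` to be replaced by its component of degree `l - 2 -
    -- P.deg e s`.
    refine Submodule.closure_induction
      (p := fun (a : P.ι (e + 1) → A) _ => ∃ h : (P.ι e →₀ A) →ₗ[Aᵐᵒᵖ] A,
      (∀ s', h (Finsupp.single s' 1) ∈ component 𝒜 (-P.deg e s + P.deg e s')) ∧
        (∀ t, h (P.d e (Finsupp.single t 1)) = intProj 𝒜 (l - 1 - P.deg e s) (a t)) ∧
          h (Finsupp.single s 1) = 0) ?_ ?_ ?_ (hq.mem_span_left b hrel)
    · exact ⟨0, fun s' => zero_mem _, fun t => by simp, rfl⟩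
    · rintro a a' _ _ ⟨f, hf, hf', hf''⟩ ⟨g, hg, hg', hg''⟩
      exact ⟨f + g, fun s' => add_mem (hf s') (hg s'),
        fun t => by rw [LinearMap.add_apply, hf', hg', Pi.add_apply, map_add],
        by rw [LinearMap.add_apply, hf'', hg'', add_zero]⟩
    · rintro c r ⟨hr, hr0⟩
      simp only [hb] at hr0
      let f : (P.ι (e + 1) →₀ A) →ₗ[Aᵐᵒᵖ] A := freeLift r
      have hf : ∀ t, f (Finsupp.single t 1) = r t := fun t => by simp [f]
      have hr' : ∀ t, r t ∈ component 𝒜 1 := fun t => by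
        have := hr t
        rwa [← component_natCast 𝒜] at this
      have hcob : f ∈ P.coboundaries (e + 1) (2 - l) := by
        refine mem_coboundaries (hext _ _ fun h => by omega) (fun t => ?_) (hcomp f ?_)
        · rw [hf, hpen, show 2 - l + (l - 1) = 1 by ring]
          exact hr' t
        · rw [hsum, ← hr0]
          exact Finset.sum_congr rfl fun t _ => by rw [hf]
      obtain ⟨h, hh, hhf⟩ := exists_of_mem_coboundaries hcob
      have hh' : ∀ t, h (P.d e (Finsupp.single t 1)) = r t := fun t => by
        rw [← hf, ← hhf, LinearMap.comp_apply]
      refine ⟨intProj 𝒜 (l - 2 - P.deg e s) c • h, fun s' => ?_, fun t => ?_, ?_⟩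
      · have := mul_mem_component 𝒜 (intProj_mem 𝒜 (l - 2 - P.deg e s) c) (hh s')
        rwa [show l - 2 - P.deg e s + (2 - l + P.deg e s') = -P.deg e s + P.deg e s' by
          ring] at this
      · rw [LinearMap.smul_apply, hh', smul_eq_mul, ← intProj_mul_right (hr' t),
          show l - 2 - P.deg e s + 1 = l - 1 - P.deg e s by ring]
        rfl
      · rw [LinearMap.smul_apply, eq_zero_of_mem_component (by omega) (hh s), smul_zero]
  obtain ⟨h, hh, hd, hs⟩ := key
  -- As for the penultimate term, `h` agrees with the dual vector of `s` on boundaries but vanishes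
  -- at `s`, since `P.deg e s < l - 2`.
  have hcob : Finsupp.lapply s - h ∈ P.coboundaries e (-P.deg e s) := by
    refine mem_coboundaries (hext _ _ fun h => by omega)
      (fun s' => sub_mem (lapply_mem_component s s') (hh s')) ?_
    refine hom_ext_single fun t => ?_
    have ht := P.d_homogeneous e t s
    rw [hpen] at ht
    rw [LinearMap.comp_apply, LinearMap.sub_apply, hd, Finsupp.lapply_apply, intProj_of_mem ht,
      sub_self, LinearMap.zero_apply]
  have := hP.apply_mem_of_mem_coboundaries hcob s
  rw [LinearMap.sub_apply, hs, Finsupp.lapply_apply, Finsupp.single_eq_same, sub_zero] at this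
  exact one_notMem_augmentationIdeal this

end GradedFreeResolution

/-! ### Monotonicity -/

section Main

variable {K A : Type*} [Field K] [Ring A] [Algebra K A] {𝒜 : ℕ → Submodule K A} [GradedAlgebra 𝒜]

theorem HasPureMinimalResolution.isMonotonic (h𝒜 : IsStandardGraded 𝒜)
    (h : HasPureMinimalResolution 𝒜) : IsMonotonic 𝒜 := by
  have := h𝒜.nontrivial
  obtain ⟨d, hd, P, hP, hfin, hpure⟩ := h
  refine ⟨d, hd, P, hP, hfin, fun i s t => ?_⟩
  obtain ⟨a, ha⟩ := hpure i
  obtain ⟨s', hs'⟩ := hP.exists_deg_lt t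
  rw [ha] at hs' ⊢
  exact hs'.le

theorem hasPureMinimalResolution_of_deg (h𝒜 : IsStandardGraded 𝒜) {d : ℕ}
    (hd : rightGlobalDimension A = d) {P : GradedFreeResolution 𝒜} (hP : P.IsMinimal) {a : ℕ → ℤ}
    (ha : ∀ i s, P.deg i s = a i) : HasPureMinimalResolution 𝒜 :=
  ⟨d, hd, P, hP, hP.isFiniteOfLength_of_pure h𝒜 (fun i => ⟨a i, ha i⟩) hd, fun i => ⟨a i, ha i⟩⟩

/-- The shape of the minimal resolution of an Artin-Schelter regular algebra. -/
theorem IsASRegular.exists_resolution (h𝒜 : IsStandardGraded 𝒜) {d : ℕ} (h : IsASRegular 𝒜 d) :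
    ∃ (P : GradedFreeResolution 𝒜) (l : ℤ), P.IsMinimal ∧ P.IsFiniteOfLength d ∧
      (∀ i < d, ∀ s, ∃ t, P.deg i s < P.deg (i + 1) t) ∧
      (∀ s, P.deg 0 s = 0) ∧ (∀ s, P.deg 1 s = 1) ∧ (∀ s, P.deg d s = l) ∧
      (∀ i, i + 1 = d → ∀ s, P.deg i s = l - 1) ∧
      (IsQuadratic 𝒜 → (∀ s, P.deg 2 s = 2) ∧ ∀ i, i + 2 = d → ∀ s, P.deg i s = l - 2) := by
  have := h𝒜.nontrivial
  obtain ⟨l, hG⟩ := h.gorenstein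
  obtain ⟨P, hP, hfin, ⟨u, hu⟩, h0, hsurj⟩ := exists_minimal_resolution h𝒜
  obtain ⟨hext, hrank⟩ := hG P
  have hempty : ∀ i, d < i → IsEmpty (P.ι i) := fun i hi =>
    hP.isEmpty_of_lt (hP.d_eq_zero h.globalDimension) hi
  have hfinite := hP.finite_of_gorenstein hempty hext hfin
  have : Unique (P.ι 0) := ⟨⟨u⟩, hu⟩
  obtain ⟨hlast⟩ := hP.nonempty_unique_last hempty hext hrank
  refine ⟨P, l, hP, ⟨hfinite, hempty⟩, fun i hi => hP.exists_lt_deg_of_lt hext hi, h0,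
    hP.deg_one h𝒜 h0 hsurj, hP.deg_last hempty hext, ?_,
    fun hq => ⟨hP.deg_two h𝒜 hq h0 hsurj, ?_⟩⟩
  · rintro i rfl
    exact hP.deg_penultimate h𝒜 hempty hext
  · rintro i rfl
    exact hP.deg_antepenultimate h𝒜 hq hempty hext

theorem IsASRegular.isMonotonic (h𝒜 : IsStandardGraded 𝒜) {d : ℕ} (h : IsASRegular 𝒜 d)
    (hd : d ≤ 4 ∨ d ≤ 6 ∧ IsQuadratic 𝒜) : IsMonotonic 𝒜 := by
  have := h𝒜.nontrivial
  obtain ⟨P, l, hP, hfin, hlt, h0, h1, hl, hl1, hq⟩ := h.exists_resolution h𝒜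
  refine ⟨d, h.globalDimension, P, hP, hfin, fun i s t => ?_⟩
  have hid : i < d := by
    by_contra hi
    exact (hfin.2 (i + 1) (by omega)).false t
  have mono_of_source : ∀ a : ℤ, (∀ s, P.deg i s = a) → P.deg i s ≤ P.deg (i + 1) t := by
    intro a ha
    obtain ⟨s', hs'⟩ := hP.exists_deg_lt t
    rw [ha] at hs' ⊢
    exact hs'.le
  have mono_of_target : ∀ a : ℤ, (∀ t, P.deg (i + 1) t = a) → P.deg i s ≤ P.deg (i + 1) t := by
    intro a ha
    obtain ⟨t', ht'⟩ := hlt i hid s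
    rw [ha] at ht' ⊢
    exact ht'.le
  obtain rfl | rfl | hi : i = 0 ∨ i = 1 ∨ 2 ≤ i := by omega
  · exact mono_of_source 0 h0
  · exact mono_of_source 1 h1
  obtain rfl | h2 | h3 : d = i + 1 ∨ i + 1 + 1 = d ∨ i + 3 ≤ d := by omega
  · exact mono_of_target l hl
  · exact mono_of_target (l - 1) (hl1 _ h2)
  -- Here `2 ≤ i ≤ d - 3`, so `d ≥ 5` and the quadratic case applies. With `d ≤ 6`, either the
  -- source is `P₂` or the target is `P_{d-2}`.
  obtain ⟨hd6, hquad⟩ := hd.resolve_left (by omega)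
  obtain ⟨hdeg2, hdegl⟩ := hq hquad
  obtain rfl | h3 : i = 2 ∨ i + 1 + 2 = d := by omega
  · exact mono_of_source 2 hdeg2
  · exact mono_of_target (l - 2) (hdegl _ h3)

end Main

end MonotonicAlg

open MonotonicAlg in
theorem theorem3p4 {K A : Type*} [Field K] [Ring A] [Algebra K A]
    (𝒜 : ℕ → Submodule K A) [GradedAlgebra 𝒜] (h𝒜 : IsStandardGraded 𝒜) :
    (HasPureMinimalResolution 𝒜 → IsMonotonic 𝒜) ∧
    ((∃ d : ℕ, rightGlobalDimension A = d) →
      (IsKoszul 𝒜 ∨ (∃ N : ℕ, IsNKoszul 𝒜 N) ∨ (∃ p N : ℕ, IsPiecewiseKoszul 𝒜 p N)) →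
        HasPureMinimalResolution 𝒜 ∧ IsMonotonic 𝒜) ∧
    (∀ d : ℕ, d ≤ 4 → IsASRegular 𝒜 d → IsMonotonic 𝒜) ∧
    (∀ d : ℕ, d ≤ 6 → IsQuadratic 𝒜 → IsASRegular 𝒜 d → IsMonotonic 𝒜) := by
  refine ⟨fun h => h.isMonotonic h𝒜, ?_, fun d hd h => h.isMonotonic h𝒜 (Or.inl hd),
    fun d hd hq h => h.isMonotonic h𝒜 (Or.inr ⟨hd, hq⟩)⟩
  rintro ⟨d, hd⟩ h
  have hpure : HasPureMinimalResolution 𝒜 := by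
    rcases h with ⟨P, hP, hdeg⟩ | ⟨N, -, P, hP, hdeg⟩ | ⟨p, N, -, -, P, hP, hdeg⟩
    · exact hasPureMinimalResolution_of_deg h𝒜 hd hP hdeg
    · exact hasPureMinimalResolution_of_deg h𝒜 hd hP hdeg
    · exact hasPureMinimalResolution_of_deg h𝒜 hd hP hdeg
  exact ⟨hpure, hpure.isMonotonic h𝒜⟩
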